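/- All algebras are unital associative algebras over $\mathbb{C}$; $[x,y]=xy-yx$ and $\{x,y\}=xy+yx$. **Centralizer.** For $n\ge 0$ let $[n]$ be the irreducible representation of $\mathfrak{su}(2)$ of dimension $n+1$ (spin $n/2$), where $\mathfrak{su}(2)$ is generated by $\mathfrak s^1,\mathfrak s^2,\mathfrak s^3$ with $[\mathfrak s^\alpha,\mathfrak s^\beta]=i\,\epsilon_{\alpha\beta\gamma}\mathfrak s^\gamma$. For half-integers or integers $j_1,j_2,j_3$ let $s^\alpha_a$ be the action of $\mathfrak s^\alpha$ on the $a$-th factor of $[2j_1]\otimes[2j_2]\otimes[2j_3]$, and put $K_{12}=\sum_\alpha(s_1^\alpha+s_2^\alpha)^2$, $K_{23}=\sum_\alpha(s_2^\alpha+s_3^\alpha)^2$, $K_{123}=\sum_\alpha(s_1^\alpha+s_2^\alpha+s_3^\alpha)^2$. Let $\mathcal C_{j_1,j_2,j_3}$ be the algebra of all endomorphisms of $[2j_1]\otimes[2j_2]\otimes[2j_3]$ that commute with $s_1^\alpha+s_2^\alpha+s_3^\alpha$ for $\alpha=1,2,3$. **Quotiented Racah algebra.** Put $\mathcal J_{ab}=\{|j_a-j_b|,|j_a-j_b|+1,\dots,j_a+j_b\}$.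 Let $\mathcal E_{abc}$ be the set of pairs $(k,\ell)$ with $k\in\mathcal J_{ab}$ and $\ell\in\{|k-j_c|,|k-j_c|+1,\dots,k+j_c\}$, and put $\mathcal J_{123}=\{\ell : (k,\ell)\in\mathcal E_{123}\text{ for some }k\}$ and $\mathcal M_{abc}=\{\ell(\ell+1)-k(k+1) : (k,\ell)\in\mathcal E_{abc}\}$. With $\alpha_i=j_i(j_i+1)$, the algebra $\overline{\mathcal R}(\alpha_1,\alpha_2,\alpha_3)$ is generated by $A,B$ and central elements $\alpha_1,\alpha_2,\alpha_3,C$ subject to $$[B,[A,B]]=-2B^2-2\{A,B\}+2(C+\alpha_1+\alpha_2+\alpha_3)B+2(\alpha_1-C)(\alpha_3-\alpha_2),$$ $$[A,[B,A]]=-2A^2-2\{A,B\}+2(C+\alpha_1+\alpha_2+\alpha_3)A+2(\alpha_1-\alpha_2)(\alpha_3-C),$$ $$\alpha_i=j_i(j_i+1)\quad(i=1,2,3),$$ $$\prod_{j\in\mathcal J_{12}}(A-j(j+1))=0,\qquad \prod_{j\in\mathcal J_{23}}(B-j(j+1))=0,\qquad \prod_{j\in\mathcal J_{123}}(C-j(j+1))=0,$$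 $$\prod_{j\in\mathcal J_{13}}(C-A-B+\alpha_1+\alpha_2+\alpha_3-j(j+1))=0,\qquad \prod_{m\in\mathcal M_{132}}(A+B-\alpha_1-\alpha_2-\alpha_3-m)=0,$$ $$\prod_{m\in\mathcal M_{123}}(C-A-m)=0,\qquad \prod_{m\in\mathcal M_{231}}(C-B-m)=0 .$$ **One-boundary Brauer algebra.** $bB$ is the algebra generated by $e_0,e_1,s_1$ subject to $$e_0^2=\tfrac32e_0,\quad s_1^2=1,\quad e_1^2=3e_1,\quad s_1e_1=e_1s_1=e_1,$$ $$e_1e_0s_1=e_1-e_1e_0,\qquad s_1e_0e_1=e_1-e_0e_1,$$ $$4e_0s_1e_0=1+2e_0+e_1-s_1+2\{e_0,s_1-e_1\}-2s_1e_0s_1,$$ $$4e_0e_1e_0=-1+2e_0+s_1-e_1-2\{e_0,s_1-e_1\}+2s_1e_0s_1 .$$ **Theorem.** Let $j_1=\tfrac12$, $j_2=j_3=1$, so that $(\alpha_1,\alpha_2,\alpha_3)=(\tfrac34,2,2)$, and write $\mathcal A=A+\tfrac14\in\overline{\mathcal R}(\tfrac34,2,2)$. Then: 1. $\dim\overline{\mathcal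 R}(\tfrac34,2,2)=9$. 2. There is an algebra isomorphism $\overline\phi:\overline{\mathcal R}(\tfrac34,2,2)\to\mathcal C_{\frac12,1,1}$ with $\overline\phi(A)=K_{12}$, $\overline\phi(B)=K_{23}$ and $\overline\phi(C)=K_{123}$. 3. $\overline{\mathcal R}(\tfrac34,2,2)$ is presented by the generators $\mathcal A$, $B$ and the relations $$(\mathcal A-1)(\mathcal A-4)=0,\qquad B(B-2)(B-6)=0,$$ $$B\mathcal AB-\mathcal AB\mathcal A=\mathcal AB^2+B^2\mathcal A-3B^2-6\{\mathcal A,B\}+26B-16+4\mathcal A,$$ $$B\mathcal AB^2+16\mathcal AB-2\mathcal AB^2-8B\mathcal AB+12B\mathcal A+6B^2-48B-24\mathcal A+72=0;$$ that is, the algebra defined by these generators and relations is isomorphic to $\overline{\mathcal R}(\tfrac34,2,2)$ via $\mathcal A\mapsto A+\tfrac14$, $B\mapsto B$. 4. There is an algebra isomorphism $\overline{\mathcal R}(\tfrac34,2,2)\to bB$ with $\mathcal A\mapsto 4-2e_0$ and $B\mapsto 2(s_1-e_1)+4$. -/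

import Mathlib

open scoped TensorProduct

/-! Spins are recorded by the doubled spin `n = 2j : ℕ`, so that `[n]` has dimension `n + 1`. -/

/-- The carrier `ℂ^(n+1)` of the representation `[n]` of spin `n/2`. The `k`-th basis vector is the
monomial `x^(n-k) y^k` of the `n`-th symmetric power of the two-dimensional representation. -/
abbrev SpinSpace (n : ℕ) : Type := Fin (n + 1) → ℂ

/-- The raising operator `x ∂/∂y` on `[n]`. -/
noncomputable def spinPlus (n : ℕ) : Module.End ℂ (SpinSpace n) :=
  Matrix.toLin' (Matrix.of fun i k : Fin (n + 1) =>
    if (i : ℕ) + 1 = (k : ℕ) then ((k : ℕ) : ℂ) else 0)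

/-- The lowering operator `y ∂/∂x` on `[n]`. -/
noncomputable def spinMinus (n : ℕ) : Module.End ℂ (SpinSpace n) :=
  Matrix.toLin' (Matrix.of fun i k : Fin (n + 1) =>
    if (i : ℕ) = (k : ℕ) + 1 then (n : ℂ) - ((k : ℕ) : ℂ) else 0)

/-- The weight operator on `[n]`, with eigenvalues `n/2, n/2 - 1, …, -n/2`. -/
noncomputable def spinWeight (n : ℕ) : Module.End ℂ (SpinSpace n) :=
  Matrix.toLin' (Matrix.diagonal fun k : Fin (n + 1) => (n : ℂ) / 2 - ((k : ℕ) : ℂ))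

/-- The three generators `s¹, s², s³` of `su(2)` (indexed by `0, 1, 2`) acting on `[n]`. -/
noncomputable def spin (n : ℕ) : Fin 3 → Module.End ℂ (SpinSpace n) :=
  ![(1 / 2 : ℂ) • (spinPlus n + spinMinus n),
    (-Complex.I / 2) • (spinPlus n - spinMinus n),
    spinWeight n]

lemma spinPlus_apply (n : ℕ) (v : SpinSpace n) (i : Fin (n + 1)) :
    spinPlus n v i =
      if h : (i : ℕ) + 1 < n + 1 then (((i : ℕ) : ℂ) + 1) * v ⟨(i : ℕ) + 1, h⟩ else 0 := by
  simp only [spinPlus, Matrix.toLin'_apply, Matrix.mulVec, dotProduct, Matrix.of_apply]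
  split_ifs with h
  · rw [Finset.sum_eq_single ⟨(i : ℕ) + 1, h⟩]
    · simp
    · intro b _ hb
      rw [if_neg, zero_mul]
      intro hc
      exact hb (Fin.ext hc.symm)
    · simp
  · apply Finset.sum_eq_zero
    intro b _
    rw [if_neg, zero_mul]
    have := b.2
    omega

lemma spinMinus_apply (n : ℕ) (v : SpinSpace n) (i : Fin (n + 1)) :
    spinMinus n v i =
      if h : 0 < (i : ℕ) then
        ((n : ℂ) - (((i : ℕ) : ℂ) - 1)) * v ⟨(i : ℕ) - 1, by omega⟩ else 0 := by
  simp only [spinMinus, Matrix.toLin'_apply, Matrix.mulVec, dotProduct, Matrix.of_apply]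
  split_ifs with h
  · rw [Finset.sum_eq_single ⟨(i : ℕ) - 1, by omega⟩]
    · rw [if_pos (by simp only; omega)]
      push_cast [Nat.cast_sub (show 1 ≤ (i : ℕ) from h)]
      ring
    · intro b _ hb
      rw [if_neg, zero_mul]
      intro hc
      exact hb (Fin.ext (by simp only; omega))
    · simp
  · apply Finset.sum_eq_zero
    intro b _
    rw [if_neg, zero_mul]
    omega

lemma spinWeight_apply (n : ℕ) (v : SpinSpace n) (i : Fin (n + 1)) :
    spinWeight n v i = ((n : ℂ) / 2 - ((i : ℕ) : ℂ)) * v i := by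
  simp [spinWeight, Matrix.toLin'_apply, Matrix.mulVec_diagonal]

lemma spinPlus_comm_spinMinus (n : ℕ) : ⁅spinPlus n, spinMinus n⁆ = (2 : ℂ) • spinWeight n := by
  apply LinearMap.ext
  intro v
  funext i
  obtain ⟨i, hi⟩ := i
  simp only [Ring.lie_def, LinearMap.sub_apply, Module.End.mul_apply, LinearMap.smul_apply,
    Pi.sub_apply, Pi.smul_apply, smul_eq_mul, spinPlus_apply, spinMinus_apply, spinWeight_apply]
  rcases i with _ | i
  · by_cases h : 0 + 1 < n + 1
    · simp [h]
      ring
    · have hn : n = 0 := by omega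
      subst hn
      simp
  · by_cases h : i + 1 + 1 < n + 1
    · simp [h, hi]
      ring
    · have hn : n = i + 1 := by omega
      subst hn
      simp
      ring

lemma spinWeight_comm_spinPlus (n : ℕ) : ⁅spinWeight n, spinPlus n⁆ = spinPlus n := by
  apply LinearMap.ext
  intro v
  funext i
  simp only [Ring.lie_def, LinearMap.sub_apply, Module.End.mul_apply, Pi.sub_apply,
    spinPlus_apply, spinWeight_apply]
  split_ifs
  · push_cast
    ring
  · simp

lemma spinWeight_comm_spinMinus (n : ℕ) : ⁅spinWeight n, spinMinus n⁆ = -spinMinus n := by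
  apply LinearMap.ext
  intro v
  funext i
  simp only [Ring.lie_def, LinearMap.sub_apply, LinearMap.neg_apply, Module.End.mul_apply,
    Pi.sub_apply, Pi.neg_apply, spinMinus_apply, spinWeight_apply]
  split_ifs with h
  · push_cast [Nat.cast_sub (show 1 ≤ (i : ℕ) from h)]
    ring
  · simp

/-- The defining commutation relations `[s^α, s^β] = i ε_{αβγ} s^γ` of `su(2)` hold on `[n]`. -/
theorem spin_comm (n : ℕ) (a : Fin 3) :
    ⁅spin n a, spin n (a + 1)⁆ = Complex.I • spin n (a + 2) := by
  have h1 := spinPlus_comm_spinMinus n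
  have h2 := spinWeight_comm_spinPlus n
  have h3 := spinWeight_comm_spinMinus n
  rw [Ring.lie_def, sub_eq_iff_eq_add] at h1 h2 h3
  have hI : Complex.I * (-Complex.I / 2) = 1 / 2 := by
    linear_combination (-1 / 2) * Complex.I_mul_I
  fin_cases a
  · simp only [spin, Ring.lie_def, Fin.zero_eta, Fin.isValue, zero_add, Matrix.cons_val,
      smul_mul_assoc, mul_smul_comm, add_mul, mul_add, sub_mul, mul_sub, h1]
    module
  · have e1 : (⟨1, by omega⟩ : Fin 3) + 1 = 2 := rfl
    have e2 : (⟨1, by omega⟩ : Fin 3) + 2 = 0 := rfl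
    rw [e1, e2]
    simp only [spin, Ring.lie_def, Fin.mk_one, Fin.isValue, Matrix.cons_val,
      smul_mul_assoc, mul_smul_comm, sub_mul, mul_sub, h2, h3]
    module
  · have e1 : (⟨2, by omega⟩ : Fin 3) + 1 = 0 := rfl
    have e2 : (⟨2, by omega⟩ : Fin 3) + 2 = 1 := rfl
    rw [e1, e2]
    simp only [spin, Ring.lie_def, Fin.reduceFinMk, Fin.isValue, Matrix.cons_val,
      smul_mul_assoc, mul_smul_comm, add_mul, mul_add, h2, h3, smul_smul, hI]
    module

/-- The representation `[n]` is irreducible. -/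
theorem spin_irreducible (n : ℕ) (W : Submodule ℂ (SpinSpace n))
    (hW : ∀ a, ∀ v ∈ W, spin n a v ∈ W) : W = ⊥ ∨ W = ⊤ := by
  have hI : Complex.I * (-Complex.I / 2) = 1 / 2 := by
    linear_combination (-1 / 2) * Complex.I_mul_I
  have hP : ∀ v ∈ W, spinPlus n v ∈ W := by
    intro v hv
    have h : spinPlus n = spin n 0 + Complex.I • spin n 1 := by
      simp only [spin, Fin.isValue, Matrix.cons_val, smul_smul, hI]
      module
    rw [h]
    exact W.add_mem (hW 0 v hv) (W.smul_mem _ (hW 1 v hv))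
  have hM : ∀ v ∈ W, spinMinus n v ∈ W := by
    intro v hv
    have h : spinMinus n = spin n 0 - Complex.I • spin n 1 := by
      simp only [spin, Fin.isValue, Matrix.cons_val, smul_smul, hI]
      module
    rw [h]
    exact W.sub_mem (hW 0 v hv) (W.smul_mem _ (hW 1 v hv))
  refine or_iff_not_imp_left.mpr fun hbot => ?_
  obtain ⟨w, hw, hw0⟩ := W.ne_bot_iff.mp hbot
  have top : ∀ k : ℕ, ∀ v ∈ W, v ≠ 0 → (∀ i : Fin (n + 1), k < (i : ℕ) → v i = 0) →
      (Pi.single 0 1 : SpinSpace n) ∈ W := by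
    intro k
    induction k with
    | zero =>
      intro v hv hv0 hz
      have hne : v 0 ≠ 0 := by
        intro h0
        apply hv0
        funext i
        by_cases hi : 0 < (i : ℕ)
        · exact hz i hi
        · have : i = 0 := Fin.ext (Nat.eq_zero_of_not_pos hi)
          rw [this, h0]
          rfl
      have : (Pi.single 0 1 : SpinSpace n) = (v 0)⁻¹ • v := by
        funext i
        by_cases hi : i = 0
        · subst hi
          simp [hne]
        · have h' : 0 < (i : ℕ) := Nat.pos_of_ne_zero fun h => hi (Fin.ext h)
          simp [hi, hz i h']
      rw [this]
      exact W.smul_mem _ hv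
    | succ k ih =>
      intro v hv hv0 hz
      by_cases h : ∀ i : Fin (n + 1), (i : ℕ) = k + 1 → v i = 0
      · refine ih v hv hv0 fun i hi => ?_
        by_cases hk : (i : ℕ) = k + 1
        · exact h i hk
        · exact hz i (by omega)
      · push Not at h
        obtain ⟨i, hik, hi⟩ := h
        refine ih _ (hP v hv) ?_ ?_
        · intro h0
          have hlt := i.2
          have h1 := congrFun h0 ⟨k, by omega⟩
          rw [spinPlus_apply, dif_pos (by simp only; omega)] at h1
          have hi' : (⟨k + 1, by omega⟩ : Fin (n + 1)) = i := Fin.ext hik.symm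
          simp only [hi', Pi.zero_apply, mul_eq_zero, hi, or_false] at h1
          exact Nat.cast_add_one_ne_zero k h1
        · intro j hj
          rw [spinPlus_apply]
          split_ifs with hlt
          · rw [hz _ (by simp only; omega), mul_zero]
          · rfl
  have e0 : (Pi.single 0 1 : SpinSpace n) ∈ W :=
    top n w hw hw0 fun i hi => absurd i.2 (by omega)
  have ek : ∀ k : ℕ, ∀ hk : k < n + 1, (Pi.single ⟨k, hk⟩ 1 : SpinSpace n) ∈ W := by
    intro k
    induction k with
    | zero => exact fun _ => e0
    | succ k ih =>
      intro hk
      have hne : (n : ℂ) - (k : ℂ) ≠ 0 := by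
        rw [sub_ne_zero]
        exact_mod_cast (by omega : n ≠ k)
      have : (Pi.single ⟨k + 1, hk⟩ 1 : SpinSpace n) =
          ((n : ℂ) - (k : ℂ))⁻¹ • spinMinus n (Pi.single ⟨k, by omega⟩ 1) := by
        funext i
        rw [Pi.smul_apply, spinMinus_apply]
        by_cases hi : i = ⟨k + 1, hk⟩
        · subst hi
          simp [hne]
        · rw [Pi.single_eq_of_ne hi]
          split_ifs with h0
          · rw [Pi.single_eq_of_ne, mul_zero, smul_zero]
            intro h
            have := congrArg Fin.val h
            simp only at this
            exact hi (Fin.ext (by simp only; omega))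
          · rw [smul_zero]
      rw [this]
      exact W.smul_mem _ (hM _ (ih _))
  rw [eq_top_iff]
  intro v _
  rw [← Finset.univ_sum_single v]
  refine W.sum_mem fun i _ => ?_
  have : (Pi.single i (v i) : SpinSpace n) = v i • Pi.single i 1 := by
    rw [← Pi.single_smul, smul_eq_mul, mul_one]
  rw [this]
  exact W.smul_mem _ (ek i i.2)

/-! ### The threefold tensor product, intermediate Casimirs, and the centralizer -/

/-- The representation space `[n₁] ⊗ [n₂] ⊗ [n₃]`. -/
abbrev SpinTensor (n₁ n₂ n₃ : ℕ) : Type :=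
  SpinSpace n₁ ⊗[ℂ] (SpinSpace n₂ ⊗[ℂ] SpinSpace n₃)

/-- `siteSpin n₁ n₂ n₃ a α` is the generator `s^α` acting on the `a`-th tensor factor (the factors
are numbered `0, 1, 2`) and as the identity on the two others. -/
noncomputable def siteSpin (n₁ n₂ n₃ : ℕ) (a α : Fin 3) : Module.End ℂ (SpinTensor n₁ n₂ n₃) :=
  ![TensorProduct.map (spin n₁ α) LinearMap.id,
    TensorProduct.map LinearMap.id (TensorProduct.map (spin n₂ α) LinearMap.id),
    TensorProduct.map LinearMap.id (TensorProduct.map LinearMap.id (spin n₃ α))] a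

/-- The Casimir `∑_α (∑_{a ∈ s} s^α_a)²` attached to a set `s` of tensor factors. -/
noncomputable def siteCasimir (n₁ n₂ n₃ : ℕ) (s : Finset (Fin 3)) :
    Module.End ℂ (SpinTensor n₁ n₂ n₃) :=
  ∑ α : Fin 3, (∑ a ∈ s, siteSpin n₁ n₂ n₃ a α) ^ 2

/-- The intermediate Casimir `K₁₂`. -/
noncomputable def casimir12 (n₁ n₂ n₃ : ℕ) : Module.End ℂ (SpinTensor n₁ n₂ n₃) :=
  siteCasimir n₁ n₂ n₃ {0, 1}

/-- The intermediate Casimir `K₂₃`. -/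
noncomputable def casimir23 (n₁ n₂ n₃ : ℕ) : Module.End ℂ (SpinTensor n₁ n₂ n₃) :=
  siteCasimir n₁ n₂ n₃ {1, 2}

/-- The total Casimir `K₁₂₃`. -/
noncomputable def casimir123 (n₁ n₂ n₃ : ℕ) : Module.End ℂ (SpinTensor n₁ n₂ n₃) :=
  siteCasimir n₁ n₂ n₃ {0, 1, 2}

/-- The centralizer of the diagonal action of `su(2)` on `[n₁] ⊗ [n₂] ⊗ [n₃]`: all endomorphisms
that commute with `s^α_1 + s^α_2 + s^α_3` for every `α`. -/
noncomputable def spinCentralizer (n₁ n₂ n₃ : ℕ) :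
    Subalgebra ℂ (Module.End ℂ (SpinTensor n₁ n₂ n₃)) :=
  Subalgebra.centralizer ℂ (Set.range fun α : Fin 3 => ∑ a : Fin 3, siteSpin n₁ n₂ n₃ a α)

/-! ### The index sets read off from the Bratteli diagrams -/

/-- The Casimir value `j (j + 1)` for `j = n / 2`. -/
def casimirValue (n : ℕ) : ℚ := ((n : ℚ) / 2) * ((n : ℚ) / 2 + 1)

/-- The doubled spins of the irreducible constituents of `[n] ⊗ [m]`:
`|n - m|, |n - m| + 2, …, n + m`. -/
def spinPairs (n m : ℕ) : Finset ℕ :=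
  (Finset.range (min n m + 1)).image fun r => n + m - 2 * r

/-- The edges between the second and the third row of the Bratteli diagram of `(n₁, n₂, n₃)`: the
pairs `(k, l)` for which `[k]` occurs in `[n₁] ⊗ [n₂]` and `[l]` occurs in `[k] ⊗ [n₃]`. -/
def bratteliEdges (n₁ n₂ n₃ : ℕ) : Finset (ℕ × ℕ) :=
  (spinPairs n₁ n₂).biUnion fun k => (spinPairs k n₃).image fun l => (k, l)

/-- The values `j (j + 1)`, where `[2j]` runs through the constituents of `[n] ⊗ [m]`. -/
def pairValues (n m : ℕ) : Finset ℚ := (spinPairs n m).image casimirValue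

/-- The values `j (j + 1)`, where `[2j]` runs through the third row of the Bratteli diagram. -/
def tripleValues (n₁ n₂ n₃ : ℕ) : Finset ℚ :=
  (bratteliEdges n₁ n₂ n₃).image fun e => casimirValue e.2

/-- The differences of the Casimir values along the edges of the Bratteli diagram. -/
def edgeValues (n₁ n₂ n₃ : ℕ) : Finset ℚ :=
  (bratteliEdges n₁ n₂ n₃).image fun e => casimirValue e.2 - casimirValue e.1

/-- The element `∏_{m ∈ s} (x - m)` of a complex algebra. -/
noncomputable def charProduct {R : Type*} [Ring R] [Algebra ℂ R] (s : Finset ℚ) (x : R) : R :=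
  Polynomial.aeval x (∏ m ∈ s, (Polynomial.X - Polynomial.C (m : ℂ)))

/-! ### The universal Racah algebra and its quotient -/

/-- The anticommutator. -/
def anticomm {R : Type*} [Ring R] (x y : R) : R := x * y + y * x

/-- The generators of the universal Racah algebra; `alpha 0`, `alpha 1`, `alpha 2` stand for
`α₁, α₂, α₃`. -/
inductive RacahGen : Type
  | A : RacahGen
  | B : RacahGen
  | C : RacahGen
  | alpha : Fin 3 → RacahGen

/-- The free algebra generator attached to a generator of the Racah algebra. -/
noncomputable def freeRacah (g : RacahGen) : FreeAlgebra ℂ RacahGen := FreeAlgebra.ι ℂ g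

open RacahGen in
/-- The defining relations of the universal Racah algebra. -/
inductive UniversalRacahRel : FreeAlgebra ℂ RacahGen → FreeAlgebra ℂ RacahGen → Prop
  | central_C (g : RacahGen) :
      UniversalRacahRel (freeRacah C * freeRacah g) (freeRacah g * freeRacah C)
  | central_alpha (i : Fin 3) (g : RacahGen) :
      UniversalRacahRel (freeRacah (alpha i) * freeRacah g) (freeRacah g * freeRacah (alpha i))
  | racah_B :
      UniversalRacahRel ⁅freeRacah B, ⁅freeRacah A, freeRacah B⁆⁆
        (-2 * freeRacah B ^ 2 - 2 * anticomm (freeRacah A) (freeRacah B)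
          + 2 * (freeRacah C + freeRacah (alpha 0) + freeRacah (alpha 1) + freeRacah (alpha 2))
              * freeRacah B
          + 2 * (freeRacah (alpha 0) - freeRacah C)
              * (freeRacah (alpha 2) - freeRacah (alpha 1)))
  | racah_A :
      UniversalRacahRel ⁅freeRacah A, ⁅freeRacah B, freeRacah A⁆⁆
        (-2 * freeRacah A ^ 2 - 2 * anticomm (freeRacah A) (freeRacah B)
          + 2 * (freeRacah C + freeRacah (alpha 0) + freeRacah (alpha 1) + freeRacah (alpha 2))
              * freeRacah A
          + 2 * (freeRacah (alpha 0) - freeRacah (alpha 1))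
              * (freeRacah (alpha 2) - freeRacah C))

/-- The universal Racah algebra over `ℂ`. -/
abbrev UniversalRacah : Type := RingQuot UniversalRacahRel

/-- The generators as elements of the universal Racah algebra. -/
noncomputable def racahGen (g : RacahGen) : UniversalRacah :=
  RingQuot.mkAlgHom ℂ UniversalRacahRel (freeRacah g)

open RacahGen in
/-- The additional relations of the quotiented Racah algebra for the spins
`n₁ / 2, n₂ / 2, n₃ / 2`. -/
inductive QuotientedRacahRel (n₁ n₂ n₃ : ℕ) : UniversalRacah → UniversalRacah → Prop
  | alpha1 : QuotientedRacahRel n₁ n₂ n₃ (racahGen (alpha 0))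
      (algebraMap ℂ UniversalRacah (casimirValue n₁ : ℂ))
  | alpha2 : QuotientedRacahRel n₁ n₂ n₃ (racahGen (alpha 1))
      (algebraMap ℂ UniversalRacah (casimirValue n₂ : ℂ))
  | alpha3 : QuotientedRacahRel n₁ n₂ n₃ (racahGen (alpha 2))
      (algebraMap ℂ UniversalRacah (casimirValue n₃ : ℂ))
  | char_A : QuotientedRacahRel n₁ n₂ n₃ (charProduct (pairValues n₁ n₂) (racahGen A)) 0
  | char_B : QuotientedRacahRel n₁ n₂ n₃ (charProduct (pairValues n₂ n₃) (racahGen B)) 0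
  | char_C : QuotientedRacahRel n₁ n₂ n₃ (charProduct (tripleValues n₁ n₂ n₃) (racahGen C)) 0
  | char_13 : QuotientedRacahRel n₁ n₂ n₃ (charProduct (pairValues n₁ n₃)
      (racahGen C - racahGen A - racahGen B
        + racahGen (alpha 0) + racahGen (alpha 1) + racahGen (alpha 2))) 0
  | char_A_add_B : QuotientedRacahRel n₁ n₂ n₃ (charProduct (edgeValues n₁ n₃ n₂)
      (racahGen A + racahGen B
        - racahGen (alpha 0) - racahGen (alpha 1) - racahGen (alpha 2))) 0
  | char_C_sub_A : QuotientedRacahRel n₁ n₂ n₃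
      (charProduct (edgeValues n₁ n₂ n₃) (racahGen C - racahGen A)) 0
  | char_C_sub_B : QuotientedRacahRel n₁ n₂ n₃
      (charProduct (edgeValues n₂ n₃ n₁) (racahGen C - racahGen B)) 0

/-- The quotiented Racah algebra for the spins `n₁ / 2, n₂ / 2, n₃ / 2`. -/
abbrev QuotientedRacah (n₁ n₂ n₃ : ℕ) : Type := RingQuot (QuotientedRacahRel n₁ n₂ n₃)

/-- The generators as elements of the quotiented Racah algebra. -/
noncomputable def quotRacahGen (n₁ n₂ n₃ : ℕ) (g : RacahGen) : QuotientedRacah n₁ n₂ n₃ :=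
  RingQuot.mkAlgHom ℂ (QuotientedRacahRel n₁ n₂ n₃) (racahGen g)

/-- The conjectural description of the centralizer for the spins `n₁ / 2, n₂ / 2, n₃ / 2`: there is
an isomorphism from the quotiented Racah algebra onto the centralizer that sends `A`, `B`, `C` to
`K₁₂`, `K₂₃`, `K₁₂₃`. -/
def RacahCentralizerConjecture (n₁ n₂ n₃ : ℕ) : Prop :=
  ∃ φ : QuotientedRacah n₁ n₂ n₃ ≃ₐ[ℂ] spinCentralizer n₁ n₂ n₃,
    (φ (quotRacahGen n₁ n₂ n₃ .A) : Module.End ℂ (SpinTensor n₁ n₂ n₃)) = casimir12 n₁ n₂ n₃ ∧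
    (φ (quotRacahGen n₁ n₂ n₃ .B) : Module.End ℂ (SpinTensor n₁ n₂ n₃)) = casimir23 n₁ n₂ n₃ ∧
    (φ (quotRacahGen n₁ n₂ n₃ .C) : Module.End ℂ (SpinTensor n₁ n₂ n₃)) = casimir123 n₁ n₂ n₃

/-! ### The simplified presentation with two generators -/

/-- The two generators `𝒜` and `B`. -/
inductive TwoGen : Type
  | A : TwoGen
  | B : TwoGen

/-- The free algebra generator attached to one of the two generators. -/
noncomputable def freeTwo (g : TwoGen) : FreeAlgebra ℂ TwoGen := FreeAlgebra.ι ℂ g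

open TwoGen in
/-- The relations of the simplified presentation. -/
inductive SimplifiedRel : FreeAlgebra ℂ TwoGen → FreeAlgebra ℂ TwoGen → Prop
  | char_A : SimplifiedRel ((freeTwo A - 1) * (freeTwo A - 4)) 0
  | char_B : SimplifiedRel (freeTwo B * (freeTwo B - 2) * (freeTwo B - 6)) 0
  | cubic : SimplifiedRel
      (freeTwo B * freeTwo A * freeTwo B - freeTwo A * freeTwo B * freeTwo A)
      (freeTwo A * freeTwo B ^ 2 + freeTwo B ^ 2 * freeTwo A - 3 * freeTwo B ^ 2
        - 6 * anticomm (freeTwo A) (freeTwo B) + 26 * freeTwo B - 16 + 4 * freeTwo A)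
  | quartic : SimplifiedRel
      (freeTwo B * freeTwo A * freeTwo B ^ 2 + 16 * (freeTwo A * freeTwo B)
        - 2 * (freeTwo A * freeTwo B ^ 2) - 8 * (freeTwo B * freeTwo A * freeTwo B)
        + 12 * (freeTwo B * freeTwo A) + 6 * freeTwo B ^ 2 - 48 * freeTwo B
        - 24 * freeTwo A + 72) 0

/-- The algebra with generators `𝒜`, `B` and the relations of the simplified presentation. -/
abbrev SimplifiedAlgebra : Type := RingQuot SimplifiedRel

/-- The generators as elements of the algebra they present. -/
noncomputable def simplifiedGen (g : TwoGen) : SimplifiedAlgebra :=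
  RingQuot.mkAlgHom ℂ SimplifiedRel (freeTwo g)

/-! ### The one-boundary Brauer algebra -/

/-- The generators `e₀`, `e₁`, `s₁` of the one-boundary Brauer algebra. -/
inductive BrauerGen : Type
  | e0 : BrauerGen
  | e1 : BrauerGen
  | s1 : BrauerGen

/-- The free algebra generator attached to a generator of the one-boundary Brauer algebra. -/
noncomputable def freeBrauer (g : BrauerGen) : FreeAlgebra ℂ BrauerGen := FreeAlgebra.ι ℂ g

open BrauerGen in
/-- The defining relations of the one-boundary Brauer algebra. -/
inductive OneBoundaryBrauerRel : FreeAlgebra ℂ BrauerGen → FreeAlgebra ℂ BrauerGen → Prop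
  | e0_sq : OneBoundaryBrauerRel (freeBrauer e0 ^ 2) ((3 / 2 : ℂ) • freeBrauer e0)
  | s1_sq : OneBoundaryBrauerRel (freeBrauer s1 ^ 2) 1
  | e1_sq : OneBoundaryBrauerRel (freeBrauer e1 ^ 2) (3 * freeBrauer e1)
  | s1_e1 : OneBoundaryBrauerRel (freeBrauer s1 * freeBrauer e1) (freeBrauer e1)
  | e1_s1 : OneBoundaryBrauerRel (freeBrauer e1 * freeBrauer s1) (freeBrauer e1)
  | e1_e0_s1 : OneBoundaryBrauerRel (freeBrauer e1 * freeBrauer e0 * freeBrauer s1)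
      (freeBrauer e1 - freeBrauer e1 * freeBrauer e0)
  | s1_e0_e1 : OneBoundaryBrauerRel (freeBrauer s1 * freeBrauer e0 * freeBrauer e1)
      (freeBrauer e1 - freeBrauer e0 * freeBrauer e1)
  | e0_s1_e0 : OneBoundaryBrauerRel (4 * (freeBrauer e0 * freeBrauer s1 * freeBrauer e0))
      (1 + 2 * freeBrauer e0 + freeBrauer e1 - freeBrauer s1
        + 2 * anticomm (freeBrauer e0) (freeBrauer s1 - freeBrauer e1)
        - 2 * (freeBrauer s1 * freeBrauer e0 * freeBrauer s1))
  | e0_e1_e0 : OneBoundaryBrauerRel (4 * (freeBrauer e0 * freeBrauer e1 * freeBrauer e0))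
      (-1 + 2 * freeBrauer e0 + freeBrauer s1 - freeBrauer e1
        - 2 * anticomm (freeBrauer e0) (freeBrauer s1 - freeBrauer e1)
        + 2 * (freeBrauer s1 * freeBrauer e0 * freeBrauer s1))

/-- The one-boundary Brauer algebra `bB` over `ℂ`. -/
abbrev OneBoundaryBrauer : Type := RingQuot OneBoundaryBrauerRel

/-- The generators as elements of the one-boundary Brauer algebra. -/
noncomputable def brauerGen (g : BrauerGen) : OneBoundaryBrauer :=
  RingQuot.mkAlgHom ℂ OneBoundaryBrauerRel (freeBrauer g)

/-! Everything is compared with the block algebra `M₂(ℂ) × M₂(ℂ) × ℂ`, of dimension 9. It enters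
because `[1] ⊗ [2] ⊗ [2]` decomposes as `2[1] ⊕ 2[3] ⊕ [5]`. In the spirit of Schur's lemma, an
endomorphism commuting with `su(2)` preserves the space of highest weight vectors of each weight and
is determined by its action there, that is, by two 2×2 matrices and one scalar. This embeds the
centralizer into the block algebra (`blockHom_injective`); surjectivity is not needed beforehand.

The core is the chain `SimplifiedAlgebra → QuotientedRacah 1 2 2 → spinCentralizer 1 2 2 →
BlockAlgebra`. The first map exists because the Racah relations imply the simplified ones
(`RacahTriple.simplifiedPair`), and it is onto because the central element `C` is a polynomial in
`A` and `B` (`RacahTriple.four_mul`). The second exists because relations in the centralizer may be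
tested on block matrices (`exists_quotientedRacah_hom`). The simplified algebra is spanned by nine
words (`SimplifiedPair.adjoin_le_span`), and their images in the block algebra are independent
(`linearIndependent_normalWords_block`). So the composite is an injection between spaces of
dimension 9, hence bijective, and this forces every map of the chain to be bijective.

The Brauer algebra is squeezed in the same way: the simplified algebra maps onto it
(`BrauerTriple.simplifiedPair`), and explicit matrices for `e₀`, `e₁`, `s₁` map it on to the block
algebra so that the composite is the same injection.

The identities in noncommuting variables are certified by explicit combinations of the relations,
multiplied on the left and on the right. -/

/-! ### Consequences of the simplified and of the Racah relations in an arbitrary ring -/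

section Presentations

variable {R : Type*} [Ring R]

/-- The defining relations of the simplified presentation, for two elements of a ring. -/
structure SimplifiedPair (a b : R) : Prop where
  char_A : (a - 1) * (a - 4) = 0
  char_B : b * (b - 2) * (b - 6) = 0
  cubic : b * a * b - a * b * a = a * b ^ 2 + b ^ 2 * a - 3 * b ^ 2
      - 6 * anticomm a b + 26 * b - 16 + 4 * a
  quartic : b * a * b ^ 2 + 16 * (a * b) - 2 * (a * b ^ 2) - 8 * (b * a * b) + 12 * (b * a)
      + 6 * b ^ 2 - 48 * b - 24 * a + 72 = 0

theorem SimplifiedPair.expanded {a b : R} (h : SimplifiedPair a b) :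
    a * a - 5 * a + 4 = 0 ∧ b * b * b - 8 * (b * b) + 12 * b = 0 ∧
    b * a * b - a * b * a - (a * b * b + b * b * a - 3 * (b * b) - 6 * (a * b + b * a)
      + 26 * b - 16 + 4 * a) = 0 ∧
    b * a * b * b + 16 * (a * b) - 2 * (a * b * b) - 8 * (b * a * b) + 12 * (b * a)
      + 6 * (b * b) - 48 * b - 24 * a + 72 = 0 := by
  obtain ⟨hA, hB, hc, hq⟩ := h
  simp only [anticomm] at hc
  refine ⟨?_, ?_, ?_, ?_⟩
  · linear_combination (norm := grind) hA
  · linear_combination (norm := grind) hB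
  · linear_combination (norm := grind) hc
  · linear_combination (norm := grind) hq

theorem eq_of_natCast_mul_sub_eq_zero [Algebra ℂ R] {n : ℕ} (hn : n ≠ 0) {x y : R}
    (h : (n : R) * (x - y) = 0) : x = y := by
  have h' : (n : ℂ) • (x - y) = 0 := by rw [Algebra.smul_def, map_natCast, h]
  exact sub_eq_zero.mp ((smul_eq_zero.mp h').resolve_left (by exact_mod_cast hn))

section

variable {a b z : R}

/-- With the four lemmas that follow, this supplies the nontrivial entries of the left
multiplication table on the nine words `normalWords`. `bba` and `babb` are the cubic and the quartic
relation solved for one word. The other three come from multiplying the cubic relation by `a` and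
`b` on both sides and eliminating, which produces twice the identity. -/
theorem SimplifiedPair.abab [Algebra ℂ R] (h : SimplifiedPair a b) :
    a * (b * a * b) = 2 * a * b * a + 2 * a * b * b + 4 * b * a * b - 8 * a * b - 8 * b * a
      - 8 * b * b + 8 * a + 32 * b - 32 := by
  obtain ⟨hA, hB, hc, hq⟩ := h.expanded
  refine eq_of_natCast_mul_sub_eq_zero (n := 2) (by norm_num) ?_
  push_cast
  linear_combination (norm := grind)
    -b * b * hA - hc * a + 4 * hc + 6 * b * hA - b * hc - hB * a - hc * b - a * hB + 6 * hB + a *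
    hc - 6 * hA * b - a * b * hA + hA * b * b + hA * b * a

theorem SimplifiedPair.bba (h : SimplifiedPair a b) :
    b * b * a = -a * b * a - a * b * b + b * a * b + 6 * a * b + 6 * b * a + 3 * b * b
      - 4 * a - 26 * b + 16 := by
  obtain ⟨hA, hB, hc, hq⟩ := h.expanded
  linear_combination (norm := grind)
    -hc

theorem SimplifiedPair.baba [Algebra ℂ R] (h : SimplifiedPair a b) :
    b * a * b * a = -2 * a * b * b + 6 * b * a * b + 4 * a * b + 4 * b * a - 2 * b * b
      - 20 * b := by
  obtain ⟨hA, hB, hc, hq⟩ := h.expanded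
  refine eq_of_natCast_mul_sub_eq_zero (n := 2) (by norm_num) ?_
  push_cast
  linear_combination (norm := grind)
    -b * hc - hB * a - hc * b - a * hB + 6 * hB + b * b * hA + hc * a - 6 * b * hA - a * hc + 6 *
    hA * b + a * b * hA - hA * b * b - hA * b * a

theorem SimplifiedPair.babb (h : SimplifiedPair a b) :
    b * a * b * b = 2 * a * b * b + 8 * b * a * b - 16 * a * b - 12 * b * a - 6 * b * b
      + 24 * a + 48 * b - 72 := by
  obtain ⟨hA, hB, hc, hq⟩ := h.expanded
  linear_combination (norm := grind)
    hq

theorem SimplifiedPair.bbab [Algebra ℂ R] (h : SimplifiedPair a b) :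
    b * b * a * b = -2 * a * b * a - 2 * a * b * b + 10 * b * a * b - 4 * b * a + 16 * a
      - 4 * b - 40 := by
  obtain ⟨hA, hB, hc, hq⟩ := h.expanded
  refine eq_of_natCast_mul_sub_eq_zero (n := 2) (by norm_num) ?_
  push_cast
  linear_combination (norm := grind)
    -hc * b + 2 * hq - a * hB + b * b * hA + hc * a - 4 * hc - 6 * b * hA + b * hc + hB * a - a *
    hc + 6 * hA * b + a * b * hA - hA * b * b - hA * b * a

/-- Relations satisfied by `A + 1/4`, `B` and `C + 1/4` in the quotiented Racah algebra. -/
structure RacahTriple (a b z : R) : Prop where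
  comm_a : z * a = a * z
  comm_b : z * b = b * z
  racah : -a * a * b + 2 * a * b * a - b * a * a + 2 * a * a + 2 * a * b + 2 * b * a
      - 2 * z * a - 10 * a - b - 2 * z + 8 = 0
  char_a : (a - 1) * (a - 4) = 0
  char_b : b * (b - 2) * (b - 6) = 0
  char_z : (z - 1) * (z - 4) * (z - 9) = 0
  char_sub : (z - a - b + 1) * (z - a - b + 4) = 0

theorem RacahTriple.expanded (h : RacahTriple a b z) :
    z * a - a * z = 0 ∧ z * b - b * z = 0 ∧
    -a * a * b + 2 * a * b * a - b * a * a + 2 * a * a + 2 * a * b + 2 * b * a - 2 * z * a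
      - 10 * a - b - 2 * z + 8 = 0 ∧
    a * a - 5 * a + 4 = 0 ∧
    b * b * b - 8 * b * b + 12 * b = 0 ∧
    z * z * z - 14 * z * z + 49 * z - 36 = 0 ∧
    a * a + a * b - a * z + b * a + b * b - b * z - z * a - z * b + z * z - 5 * a - 5 * b
      + 5 * z + 4 = 0 := by
  obtain ⟨h1, h2, h3, h4, h5, h6, h7⟩ := h
  refine ⟨sub_eq_zero.mpr h1, sub_eq_zero.mpr h2, h3, ?_, ?_, ?_, ?_⟩
  · linear_combination (norm := grind) h4
  · linear_combination (norm := grind) h5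
  · linear_combination (norm := grind) h6
  · linear_combination (norm := grind) h7

/-- With `a² = 5a - 4` the Racah relation expresses `2aba` through `ab + ba`, `b`, `za` and `z`.
Multiplying it by `a` gives a second expression for `aba`; eliminating `aba` leaves five times this
identity, up to a factor. -/
theorem RacahTriple.mul_add_mul [Algebra ℂ R] (h : RacahTriple a b z) :
    a * b + b * a = 5 * b - 6 * z + 2 * z * a := by
  obtain ⟨hz_a, hz_b, hRA, hA, hB, hC, h13⟩ := h.expanded
  refine eq_of_natCast_mul_sub_eq_zero (n := 5) (by norm_num) ?_
  push_cast
  linear_combination (norm := grind)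
    -24 * hz_a - 4 * hA * b * a + 2 * a * b * hA + 2 * a * hRA + 4 * a * hz_a - 7 * b * hA - 7 *
    hRA + 14 * hA - hA * b + 4 * hA * z - 4 * hA * a + 2 * hA * a * b

/-- Inserting `mul_add_mul` and `a² = 5a - 4` into `char_sub` leaves `(b - z)² = z`, so `b` is
quadratic over `ℂ[z]`. Rewriting `bab` with this, the two sides differ by `(z - 1)(z - 4)(a - 4)`.
That vanishes: where `z = 9`, `b` is a root of both `(b - 9)² = 9` and `b(b - 2)(b - 6) = 0`, so `b
= 6`, and `mul_add_mul` then gives `a = 4`. -/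
theorem RacahTriple.mul_mul_mul [Algebra ℂ R] (h : RacahTriple a b z) :
    b * a * b = b * b + 2 * z * b - 16 * z + 4 * z * a - 4 * a + 16 := by
  obtain ⟨hz_a, hz_b, hRA, hA, hB, hC, h13⟩ := h.expanded
  have L1 := sub_eq_zero.mpr h.mul_add_mul
  refine eq_of_natCast_mul_sub_eq_zero (n := 18) (by norm_num) ?_
  push_cast
  linear_combination (norm := grind)
    8 * L1 * b + 16 * hz_a * b + 16 * a * hz_b - 52 * hz_b - 6 * h13 * a * z + 6 * z * hz_a * z -
    2 * hz_a * z * z - 2 * a * hC - 2 * h13 * a + 2 * z * hz_a + 12 * hz_a * z - 2 * hz_b * a + 2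
    * hz_a * a + 10 * b * L1 - 130 * hz_a + 2 * L1 * a + 2 * hA * a - 6 * hz_b * a * z + 6 * hz_a
    * a * z + 28 * hz_b * z + 4 * b * L1 * z - 2 * L1 * b * z - 4 * hz_a * b * z - 4 * a * hz_b *
    z + 32 * h13 - 44 * L1 - 32 * hA - 4 * L1 * z * z - 4 * b * hz_a * z - b * b * L1 - 2 * b * b
    * hz_a + hB * a + 16 * b * hz_a + b * L1 * b + 2 * b * hz_a * b + 2 * b * a * hz_b - L1 * b *
    b - 2 * hz_a * b * b - 2 * a * hz_b * b - 2 * a * b * hz_b + a * hB + 6 * hz_b * b + 16 * h13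
    * z + 8 * hC - 5 * hB - 16 * hA * z + 6 * L1 * a * z + 6 * hA * a * z

/-- The words occur only in combinations that reduce to `1`, `a`, `b` over `ℂ[z]`. After reduction
the two sides differ by a multiple of `(z - 1)(z - 4)(a - 4)`, the element already killed in
`mul_mul_mul`. -/
theorem RacahTriple.cubic [Algebra ℂ R] (h : RacahTriple a b z) :
    b * a * b - a * b * a = a * b ^ 2 + b ^ 2 * a - 3 * b ^ 2
      - 6 * anticomm a b + 26 * b - 16 + 4 * a := by
  obtain ⟨hz_a, hz_b, hRA, hA, hB, hC, h13⟩ := h.expanded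
  have L1 := sub_eq_zero.mpr h.mul_add_mul
  have L2 := sub_eq_zero.mpr h.mul_mul_mul
  simp only [anticomm]
  refine eq_of_natCast_mul_sub_eq_zero (n := 1) (by norm_num) ?_
  push_cast
  linear_combination (norm := grind)
    3 * b * L1 - 2 * b * hz_a - L2 + 16 * hz_b - 2 * L1 * z - L1 * b - 2 * hz_a * b - 2 * a *
    hz_b + 12 * h13 - 6 * L1 - 12 * hA - 4 * h13 * a + 4 * z * hz_a - 4 * hz_b * a + 2 * hz_a * a
    + 3 * L1 * a + 4 * hA * a - 2 * hz_a + b * hA - 2 * a * hz_a - 2 * hA * z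

/-- Multiplying `mul_mul_mul` by `b` on the right produces `4zab`, which `-2ab²` cancels; the
remaining `ab` and `ba` combine to `12(ab + ba)`. What is left is `(z - 1)(z - 4)(2a + 4b - 2z -
14)`, zero because `a = 4` and `b = 6` where `z = 9`. -/
theorem RacahTriple.quartic [Algebra ℂ R] (h : RacahTriple a b z) :
    b * a * b ^ 2 + 16 * (a * b) - 2 * (a * b ^ 2) - 8 * (b * a * b) + 12 * (b * a)
      + 6 * b ^ 2 - 48 * b - 24 * a + 72 = 0 := by
  obtain ⟨hz_a, hz_b, hRA, hA, hB, hC, h13⟩ := h.expanded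
  have L1 := sub_eq_zero.mpr h.mul_add_mul
  have L2 := sub_eq_zero.mpr h.mul_mul_mul
  refine eq_of_natCast_mul_sub_eq_zero (n := 3) (by norm_num) ?_
  push_cast
  linear_combination (norm := grind)
    3 * L2 * b + 2 * hz_b * b + 4 * hz_a * b - 2 * b * hz_b - 2 * h13 * z + 2 * hC + 26 * h13 -
    26 * hz_b - 26 * hz_a + 10 * L1 - 26 * hA + 2 * hz_b * z + 2 * hz_a * z - 4 * h13 * b + 4 * z
    * hz_b + 7 * hB - 2 * L1 * b + 4 * hA * b + 2 * L1 * z + 2 * hA * z - 18 * L2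

theorem RacahTriple.simplifiedPair [Algebra ℂ R] (h : RacahTriple a b z) : SimplifiedPair a b :=
  ⟨h.char_a, h.char_b, h.cubic, h.quartic⟩

/-- By `mul_add_mul` the first factor is `2z(a - 3)`, and `(a - 3)(a - 2) = 2` because `a² = 5a -
4`. Hence the central generator lies in the algebra generated by `a` and `b`. -/
theorem RacahTriple.four_mul [Algebra ℂ R] (h : RacahTriple a b z) :
    4 * z = (a * b + b * a - 5 * b) * (a - 2) := by
  obtain ⟨hz_a, hz_b, hRA, hA, hB, hC, h13⟩ := h.expanded
  have L1 := sub_eq_zero.mpr h.mul_add_mul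
  linear_combination (norm := grind) -L1 * (a - 2) - 2 * z * hA

end

end Presentations

/-! ### The Brauer relations imply the simplified ones -/

section Brauer

variable {R : Type*} [Ring R]

/-- The defining relations of the one-boundary Brauer algebra, for three elements of a ring. -/
structure BrauerTriple (e f s : R) : Prop where
  e_sq : 2 * (e * e) = 3 * e
  s_sq : s * s = 1
  f_sq : f * f = 3 * f
  s_f : s * f = f
  f_s : f * s = f
  f_e_s : f * e * s = f - f * e
  s_e_f : s * e * f = f - e * f
  e_s_e : 4 * (e * s * e) = 1 + 2 * e + f - s + 2 * anticomm e (s - f) - 2 * (s * e * s)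
  e_f_e : 4 * (e * f * e) = -1 + 2 * e + s - f - 2 * anticomm e (s - f) + 2 * (s * e * s)

/-- The eigenvalues `0, 3/2` of `e` become `4, 1`. Since `s` is the identity on the image of `f`,
where `f` acts as 3, the possible eigenvalues of `s - f` are `-2, -1, 1`, which become `0, 2, 6`.
The cubic relation comes from the difference of the two relations for `e s e` and `e f e`. -/
theorem BrauerTriple.simplifiedPair {e f s : R} (h : BrauerTriple e f s) :
    SimplifiedPair (4 - 2 * e) (2 * (s - f) + 4) := by
  obtain ⟨h0, hs, h1, hsf, hfs, hfes, hsef, hese, hefe⟩ := h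
  simp only [anticomm] at hese hefe
  constructor
  · linear_combination (norm := grind) 2 * h0
  · linear_combination (norm := grind)
      8 * hs * s - 8 * hs * f - 8 * hsf * s + 8 * s * h1 + 8 * hsf - 8 * f * hs + 8 * f * hsf + 8
      * h1 * s - 8 * h1 * f + 16 * hs
  · simp only [anticomm]
    linear_combination (norm := grind)
      8 * hs * e - 8 * hsf * e - 2 * hese + 8 * hsef - 8 * hfs * e + 8 * h1 * e + 8 * hfes + 4 *
      f * e * hsf - 4 * hfes * f - 8 * h1 + 8 * e * hs - 8 * e * hsf + 2 * hefe - 8 * e * hfs + 8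
      * e * h1 - 4 * hs + 4 * hsf + 4 * hfs - 8 * h0
  · linear_combination (norm := grind)
      8 * hefe - 32 * e * hs + 64 * hs + 32 * hfs + 8 * hese * f - 32 * e * hsef + 16 * hsef + 32
      * e * hsf + 32 * hsf + 16 * hsef * s - 16 * hsef * f + 16 * hfes * s - 16 * f * e * hfs -
      16 * f * e * hsf + 16 * f * e * h1 + 8 * hefe * s + 16 * h0 * f - 32 * e * hfes + 32 * hs *
      s - 32 * hs * f - 32 * hsf * s + 32 * s * h1 - 32 * f * hs + 32 * f * hsf + 32 * h1 * s -
      32 * h1 * f - 16 * h1 + 16 * e * hfs - 16 * e * h1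

end Brauer

/-! ### Nine words span an algebra generated by a simplified pair -/

section Words

variable {R : Type*} [Ring R]

/-- Nine words in two letters that span every algebra generated by a `SimplifiedPair`. -/
def normalWords (a b : R) : Fin 9 → R :=
  ![1, a, b, a * b, b * a, b * b, a * b * a, a * b * b, b * a * b]

theorem map_normalWords {S F : Type*} [Ring S] [FunLike F R S] [RingHomClass F R S] (f : F)
    (a b : R) (i : Fin 9) : f (normalWords a b i) = normalWords (f a) (f b) i := by
  fin_cases i <;> simp [normalWords]

variable [Algebra ℂ R] {a b : R}

/-- Stability under left multiplication passes from the generators to all of the generated algebra,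
and `x = x * 1`. So only left products have to be tabulated. -/
theorem toSubmodule_adjoin_le_of_mul_mem {s : Set R} {W : Submodule ℂ R} (h1 : (1 : R) ∈ W)
    (h : ∀ x ∈ s, ∀ w ∈ W, x * w ∈ W) : Subalgebra.toSubmodule (Algebra.adjoin ℂ s) ≤ W := by
  intro x hx
  suffices ∀ w ∈ W, x * w ∈ W by simpa using this 1 h1
  rw [Subalgebra.mem_toSubmodule] at hx
  induction hx using Algebra.adjoin_induction with
  | mem x hx => exact h x hx
  | algebraMap r =>
    intro w hw
    rw [← Algebra.smul_def]
    exact W.smul_mem r hw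
  | add x y hx hy ihx ihy =>
    intro w hw
    rw [add_mul]
    exact W.add_mem (ihx w hw) (ihy w hw)
  | mul x y hx hy ihx ihy =>
    intro w hw
    rw [mul_assoc]
    exact ihx _ (ihy w hw)

theorem SimplifiedPair.adjoin_le_span (h : SimplifiedPair a b) :
    Subalgebra.toSubmodule (Algebra.adjoin ℂ {a, b}) ≤
      Submodule.span ℂ (Set.range (normalWords a b)) := by
  set W := Submodule.span ℂ (Set.range (normalWords a b)) with hW
  have hm : ∀ i, normalWords a b i ∈ W := fun i => Submodule.subset_span ⟨i, rfl⟩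
  have m0 : (1 : R) ∈ W := hm 0
  have m1 : a ∈ W := hm 1
  have m2 : b ∈ W := hm 2
  have m3 : a * b ∈ W := hm 3
  have m4 : b * a ∈ W := hm 4
  have m5 : b * b ∈ W := hm 5
  have m6 : a * b * a ∈ W := hm 6
  have m7 : a * b * b ∈ W := hm 7
  have m8 : b * a * b ∈ W := hm 8
  -- The coefficient vectors supplied below are rows of the left multiplication table, ordered as
  -- `1, a, b, ab, ba, bb, aba, abb, bab`.
  have key : ∀ (c : Fin 9 → ℤ) (x : R), x = ∑ i, (c i : R) * normalWords a b i → x ∈ W := by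
    intro c x hx
    rw [hx]
    refine W.sum_mem fun i _ => ?_
    rw [← zsmul_eq_mul]
    exact W.toAddSubgroup.zsmul_mem (hm i) _
  have haa : a * a = 5 * a - 4 := by
    linear_combination (norm := grind) h.expanded.1
  have hbbb : b * (b * b) = 8 * (b * b) - 12 * b := by
    linear_combination (norm := grind) h.expanded.2.1
  refine toSubmodule_adjoin_le_of_mul_mem m0 fun x hx w hw => ?_
  induction hw using Submodule.span_induction with
  | zero => simp
  | add u v _ _ hu hv => rw [mul_add]; exact W.add_mem hu hv
  | smul c u _ hu => rw [mul_smul_comm]; exact W.smul_mem c hu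
  | mem w hw =>
    obtain ⟨i, rfl⟩ := hw
    rcases hx with rfl | rfl
    · fin_cases i
      · simpa [normalWords] using m1
      · refine key ![-4, 5, 0, 0, 0, 0, 0, 0, 0] _ ?_
        simp [normalWords, Fin.sum_univ_succ]
        linear_combination (norm := grind) haa
      · simpa [normalWords] using m3
      · refine key ![0, 0, -4, 5, 0, 0, 0, 0, 0] _ ?_
        simp [normalWords, Fin.sum_univ_succ]
        linear_combination (norm := grind) haa * b
      · simpa [normalWords, mul_assoc] using m6
      · simpa [normalWords, mul_assoc] using m7
      · refine key ![0, 0, 0, 0, -4, 0, 5, 0, 0] _ ?_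
        simp [normalWords, Fin.sum_univ_succ]
        linear_combination (norm := grind) haa * b * x
      · refine key ![0, 0, 0, 0, 0, -4, 0, 5, 0] _ ?_
        simp [normalWords, Fin.sum_univ_succ]
        linear_combination (norm := grind) haa * b * b
      · refine key ![-32, 8, 32, -8, -8, -8, 2, 2, 4] _ ?_
        simp [normalWords, Fin.sum_univ_succ]
        linear_combination (norm := grind) h.abab
    · fin_cases i
      · simpa [normalWords] using m2
      · simpa [normalWords] using m4
      · simpa [normalWords] using m5
      · simpa [normalWords, mul_assoc] using m8
      · refine key ![16, -4, -26, 6, 6, 3, -1, -1, 1] _ ?_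
        simp [normalWords, Fin.sum_univ_succ]
        linear_combination (norm := grind) h.bba
      · refine key ![0, 0, -12, 0, 0, 8, 0, 0, 0] _ ?_
        simp [normalWords, Fin.sum_univ_succ]
        linear_combination (norm := grind) hbbb
      · refine key ![0, 0, -20, 4, 4, -2, 0, -2, 6] _ ?_
        simp [normalWords, Fin.sum_univ_succ]
        linear_combination (norm := grind) h.baba
      · refine key ![-72, 24, 48, -16, -12, -6, 0, 2, 8] _ ?_
        simp [normalWords, Fin.sum_univ_succ]
        linear_combination (norm := grind) h.babb
      · refine key ![-40, 16, -4, 0, -4, 0, -2, -2, 10] _ ?_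
        simp [normalWords, Fin.sum_univ_succ]
        linear_combination (norm := grind) h.bbab

end Words

/-! ### The model `M₂(ℂ) × M₂(ℂ) × ℂ` -/

section Model

/-- The semisimple algebra `M₂(ℂ) × M₂(ℂ) × ℂ`. -/
abbrev BlockAlgebra : Type :=
  Matrix (Fin 2) (Fin 2) ℂ × Matrix (Fin 2) (Fin 2) ℂ × ℂ

/-- The image of `A + 1/4` in the block algebra. -/
noncomputable def blockA : BlockAlgebra := (!![2, 1; 2, 3], !![3, 2; 1, 2], 4)

/-- The image of `B` in the block algebra. -/
noncomputable def blockB : BlockAlgebra := (!![0, -1; 0, 2], !![2, -2; 0, 6], 6)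

/-- The image of `C + 1/4` in the block algebra. -/
noncomputable def blockC : BlockAlgebra := (!![1, 0; 0, 1], !![4, 0; 0, 4], 9)

/-- The image of `e₀` in the block algebra. -/
noncomputable def blockE0 : BlockAlgebra := (!![1, -1 / 2; -1, 1 / 2], !![1 / 2, -1; -1 / 2, 1], 0)

/-- The image of `e₁` in the block algebra. -/
noncomputable def blockE1 : BlockAlgebra := (!![3, 3 / 2; 0, 0], 0, 0)

/-- The image of `s₁` in the block algebra. -/
noncomputable def blockS1 : BlockAlgebra := (!![1, 1; 0, -1], !![-1, -1; 0, 1], 1)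

theorem ofNat_fin_two (n : ℕ) [n.AtLeastTwo] :
    (OfNat.ofNat n : Matrix (Fin 2) (Fin 2) ℂ) = !![OfNat.ofNat n, 0; 0, OfNat.ofNat n] := by
  ext i j
  fin_cases i <;> fin_cases j <;> simp [Matrix.ofNat_apply] <;> exact Nat.cast_ofNat

theorem linearIndependent_normalWords_block :
    LinearIndependent ℂ (normalWords blockA blockB) := by
  rw [Fintype.linearIndependent_iff]
  intro g hg
  simp only [Fin.sum_univ_succ, normalWords, blockA, blockB] at hg
  simp [Prod.ext_iff, ← Matrix.ext_iff, Fin.forall_fin_two, Matrix.one_fin_two] at hg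
  obtain ⟨⟨⟨e00, e01⟩, e10, e11⟩, ⟨⟨f00, f01⟩, f10, f11⟩, k⟩ := hg
  intro i
  fin_cases i <;> simp only [Fin.zero_eta, Fin.mk_one, Fin.reduceFinMk]
  -- The nine words have nine matrix entries each; the coefficients here and below are the rows of
  -- the inverse of the resulting 9×9 matrix.
  · linear_combination (11/6) * e00 - (5/3) * e01 - (1/2) * e10 - (1) * e11 - (2/15) * f00 + (3/5) * f01 + (6/5) * f10 + (3/5) * f11 - (3/10) * k
  · linear_combination -(1/3) * e00 + (2/3) * e01 + (1/4) * e10 + (1/2) * e11 - (1/15) * f00 - (1/5) * f01 - (2/5) * f10 - (1/5) * f11 + (1/10) * k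
  · linear_combination -(7/12) * e00 - (1/6) * e01 + (5/12) * e10 + (1/2) * e11 + (11/30) * f00 - (2/5) * f01 - (37/30) * f10 - (8/15) * f11 + (1/4) * k
  · linear_combination -(1/4) * e00 + (1/2) * e01 - (1/2) * e10 + (1/3) * e11 - (1/10) * f00 + (1/30) * f01 + (3/10) * f10 + (1/15) * f11 - (1/20) * k
  · linear_combination (1/12) * e00 - (1/6) * e01 - (2/15) * f00 + (1/10) * f01 + (1/5) * f10 + (1/10) * f11 - (1/20) * k
  · linear_combination (1/12) * e00 - (1/6) * e11 + (1/60) * f00 + (1/20) * f01 + (3/20) * f10 + (7/60) * f11 - (1/20) * k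
  · linear_combination (1/24) * e00 - (1/12) * e01 + (1/16) * e10 - (1/8) * e11 + (1/12) * f00
  · linear_combination (1/24) * e00 - (1/12) * e01 + (1/16) * e10 - (1/24) * e11 - (1/60) * f00 + (1/30) * f01 - (1/20) * f10 + (1/60) * f11
  · linear_combination -(1/24) * e00 + (1/12) * e01 - (1/24) * e10 + (1/12) * e11 - (1/60) * f00 - (1/20) * f01 - (1/60) * f10 - (1/20) * f11 + (1/40) * k

theorem brauerTriple_block : BrauerTriple blockE0 blockE1 blockS1 := by
  constructor <;>
  simp only [blockE0, blockE1, blockS1, anticomm] <;>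
  refine Prod.ext ?_ (Prod.ext ?_ ?_) <;>
  simp only [Prod.fst_mul, Prod.snd_mul, Prod.fst_add, Prod.snd_add, Prod.fst_sub, Prod.snd_sub,
    Prod.fst_neg, Prod.snd_neg, Prod.fst_one, Prod.snd_one, Prod.fst_ofNat, Prod.snd_ofNat,
    ofNat_fin_two, Matrix.mul_fin_two, Matrix.one_fin_two, mul_zero, zero_mul] <;>
  norm_num [← Matrix.ext_iff, Fin.forall_fin_two, eq_iff_true_of_subsingleton]

/-- Via `RacahTriple.simplifiedPair` this also yields the cubic and quartic relations for `blockA`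
and `blockB`, with no further matrix computation. -/
theorem racahTriple_block : RacahTriple blockA blockB blockC := by
  constructor <;>
  simp only [blockA, blockB, blockC] <;>
  refine Prod.ext ?_ (Prod.ext ?_ ?_) <;>
  simp only [Prod.fst_mul, Prod.snd_mul, Prod.fst_add, Prod.snd_add, Prod.fst_sub, Prod.snd_sub,
    Prod.fst_neg, Prod.snd_neg, Prod.fst_one, Prod.snd_one, Prod.fst_ofNat, Prod.snd_ofNat,
    ofNat_fin_two, Matrix.mul_fin_two, Matrix.one_fin_two, mul_zero, zero_mul] <;>
  norm_num [← Matrix.ext_iff, Fin.forall_fin_two]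

end Model

/-! ### The annihilating polynomials for spins 1/2, 1, 1 -/

section CharProduct

variable {R S : Type*} [Ring R] [Algebra ℂ R] [Ring S] [Algebra ℂ S]

theorem map_charProduct (f : R →ₐ[ℂ] S) (s : Finset ℚ) (x : R) :
    f (charProduct s x) = charProduct s (f x) :=
  (Polynomial.aeval_algHom_apply f x _).symm

theorem charProduct_insert {m : ℚ} {s : Finset ℚ} (hm : m ∉ s) (x : R) :
    charProduct (insert m s) x = (x - algebraMap ℂ R (m : ℂ)) * charProduct s x := by
  simp [charProduct, Finset.prod_insert hm]

theorem charProduct_singleton (m : ℚ) (x : R) :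
    charProduct {m} x = x - algebraMap ℂ R (m : ℂ) := by
  simp [charProduct]

theorem pairValues_one_two : pairValues 1 2 = {15 / 4, 3 / 4} := by
  decide +kernel

theorem pairValues_two_two : pairValues 2 2 = {6, 2, 0} := by
  decide +kernel

theorem tripleValues_one_two_two : tripleValues 1 2 2 = {35 / 4, 15 / 4, 3 / 4} := by
  decide +kernel

/-- Five edges give four values, since 0 occurs for `(1, 1)` and for `(3, 3)`. As the last two spins
agree, this set serves both for `C - A` and for the relation on `A + B`; likewise `pairValues 1 2`
serves the pairs 12 and 13. -/
theorem edgeValues_one_two_two : edgeValues 1 2 2 = {5, 3, 0, -3} := by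
  decide +kernel

theorem edgeValues_two_two_one : edgeValues 2 2 1 = {11 / 4, 7 / 4, 3 / 4, -5 / 4, -9 / 4} := by
  decide +kernel

theorem charProduct_pairValues_one_two (x : R) : charProduct (pairValues 1 2) x =
    (x - algebraMap ℂ R (15 / 4)) * (x - algebraMap ℂ R (3 / 4)) := by
  rw [pairValues_one_two, charProduct_insert (by norm_num), charProduct_singleton]
  norm_num

theorem charProduct_pairValues_two_two (x : R) : charProduct (pairValues 2 2) x =
    (x - algebraMap ℂ R 6) * ((x - algebraMap ℂ R 2) * x) := by
  rw [pairValues_two_two, charProduct_insert (by norm_num), charProduct_insert (by norm_num),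
    charProduct_singleton]
  norm_num

theorem charProduct_tripleValues_one_two_two (x : R) : charProduct (tripleValues 1 2 2) x =
    (x - algebraMap ℂ R (35 / 4)) * ((x - algebraMap ℂ R (15 / 4)) *
      (x - algebraMap ℂ R (3 / 4))) := by
  rw [tripleValues_one_two_two, charProduct_insert (by norm_num), charProduct_insert (by norm_num),
    charProduct_singleton]
  norm_num

theorem charProduct_edgeValues_one_two_two (x : R) : charProduct (edgeValues 1 2 2) x =
    (x - algebraMap ℂ R 5) * ((x - algebraMap ℂ R 3) * (x * (x + algebraMap ℂ R 3))) := by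
  rw [edgeValues_one_two_two, charProduct_insert (by norm_num), charProduct_insert (by norm_num),
    charProduct_insert (by norm_num), charProduct_singleton]
  norm_num

theorem charProduct_edgeValues_two_two_one (x : R) : charProduct (edgeValues 2 2 1) x =
    (x - algebraMap ℂ R (11 / 4)) * ((x - algebraMap ℂ R (7 / 4)) *
      ((x - algebraMap ℂ R (3 / 4)) * ((x - algebraMap ℂ R (-5 / 4)) *
        (x - algebraMap ℂ R (-9 / 4))))) := by
  rw [edgeValues_two_two_one, charProduct_insert (by norm_num), charProduct_insert (by norm_num),
    charProduct_insert (by norm_num), charProduct_insert (by norm_num), charProduct_singleton]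
  push_cast
  rfl

end CharProduct

/-! ### Universal properties, and the dimension of the simplified algebra -/

section Lifts

variable {R : Type*} [Ring R] [Algebra ℂ R]

theorem simplifiedPair_simplifiedGen : SimplifiedPair (simplifiedGen .A) (simplifiedGen .B) := by
  have h1 := RingQuot.mkAlgHom_rel ℂ SimplifiedRel.char_A
  have h2 := RingQuot.mkAlgHom_rel ℂ SimplifiedRel.char_B
  have h3 := RingQuot.mkAlgHom_rel ℂ SimplifiedRel.cubic
  have h4 := RingQuot.mkAlgHom_rel ℂ SimplifiedRel.quartic
  simp only [anticomm, map_mul, map_add, map_sub, map_pow, map_one, map_ofNat, map_zero]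
    at h1 h2 h3 h4
  exact ⟨h1, h2, h3, h4⟩

theorem exists_simplifiedAlgebra_hom {a b : R} (h : SimplifiedPair a b) :
    ∃ f : SimplifiedAlgebra →ₐ[ℂ] R, f (simplifiedGen .A) = a ∧ f (simplifiedGen .B) = b := by
  let g : TwoGen → R := fun x => TwoGen.rec a b x
  have hA : FreeAlgebra.lift ℂ g (freeTwo .A) = a := FreeAlgebra.lift_ι_apply _ _
  have hB : FreeAlgebra.lift ℂ g (freeTwo .B) = b := FreeAlgebra.lift_ι_apply _ _
  refine ⟨RingQuot.liftAlgHom ℂ ⟨FreeAlgebra.lift ℂ g, fun x y hxy => ?_⟩, ?_, ?_⟩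
  · cases hxy <;>
      simp only [anticomm, map_mul, map_add, map_sub, map_pow, map_one, map_ofNat, map_zero, hA, hB]
    exacts [h.char_A, h.char_B, h.cubic, h.quartic]
  · rw [simplifiedGen, RingQuot.liftAlgHom_mkAlgHom_apply, hA]
  · rw [simplifiedGen, RingQuot.liftAlgHom_mkAlgHom_apply, hB]

theorem adjoin_map_eq_top {X : Type*} (f : FreeAlgebra ℂ X →ₐ[ℂ] R) (hf : Function.Surjective f) :
    Algebra.adjoin ℂ (Set.range fun x => f (FreeAlgebra.ι ℂ x)) = ⊤ := by
  rw [Set.range_comp' f, ← AlgHom.map_adjoin, FreeAlgebra.adjoin_range_ι, Algebra.map_top,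
    (AlgHom.range_eq_top f).mpr hf]

theorem adjoin_simplifiedGen :
    Algebra.adjoin ℂ {simplifiedGen .A, simplifiedGen .B} = ⊤ := by
  rw [eq_top_iff, ← adjoin_map_eq_top _ (RingQuot.mkAlgHom_surjective ℂ SimplifiedRel)]
  refine Algebra.adjoin_mono ?_
  rintro _ ⟨x, rfl⟩
  cases x
  · exact Or.inl rfl
  · exact Or.inr rfl

theorem span_normalWords_simplifiedGen :
    Submodule.span ℂ (Set.range (normalWords (simplifiedGen .A) (simplifiedGen .B))) = ⊤ := by
  rw [eq_top_iff, ← Algebra.top_toSubmodule, ← adjoin_simplifiedGen]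
  exact simplifiedPair_simplifiedGen.adjoin_le_span

/-- A linear relation among the words would persist in the block algebra, where they are
independent. With the spanning statement this makes the words a basis. -/
theorem linearIndependent_normalWords_simplifiedGen :
    LinearIndependent ℂ (normalWords (simplifiedGen .A) (simplifiedGen .B)) := by
  obtain ⟨f, hA, hB⟩ := exists_simplifiedAlgebra_hom racahTriple_block.simplifiedPair
  refine LinearIndependent.of_comp f.toLinearMap ?_
  have : ⇑f.toLinearMap ∘ normalWords (simplifiedGen .A) (simplifiedGen .B) =
      normalWords blockA blockB := by
    funext i
    simp [map_normalWords, hA, hB]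
  rw [this]
  exact linearIndependent_normalWords_block

theorem finrank_simplifiedAlgebra : Module.finrank ℂ SimplifiedAlgebra = 9 := by
  rw [Module.finrank_eq_card_basis (Module.Basis.mk linearIndependent_normalWords_simplifiedGen
    span_normalWords_simplifiedGen.ge), Fintype.card_fin]

theorem finite_simplifiedAlgebra : Module.Finite ℂ SimplifiedAlgebra :=
  Module.Finite.of_basis (Module.Basis.mk linearIndependent_normalWords_simplifiedGen
    span_normalWords_simplifiedGen.ge)

/-- Any homomorphism to the block algebra with the expected values on generators is injective. -/
theorem injective_of_simplifiedGen {f : SimplifiedAlgebra →ₐ[ℂ] BlockAlgebra}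
    (hA : f (simplifiedGen .A) = blockA) (hB : f (simplifiedGen .B) = blockB) :
    Function.Injective f := by
  rw [injective_iff_map_eq_zero]
  intro x hx
  have hx' : x ∈ Submodule.span ℂ (Set.range
      (normalWords (simplifiedGen .A) (simplifiedGen .B))) := by
    rw [span_normalWords_simplifiedGen]; trivial
  obtain ⟨c, rfl⟩ := (Submodule.mem_span_range_iff_exists_fun ℂ).mp hx'
  simp only [map_sum, map_smul, map_normalWords, hA, hB] at hx
  have := Fintype.linearIndependent_iff.mp linearIndependent_normalWords_block c hx
  simp [this]

/-- Translates between the scalar `3/2` of the presentation and the form cleared of denominators in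
`BrauerTriple`, which makes sense in every ring. -/
theorem two_mul_eq_three_mul_iff {x y : R} : 2 * y = 3 * x ↔ y = (3 / 2 : ℂ) • x := by
  have h2 : (2 : R) * y = (2 : ℂ) • y := by rw [Algebra.smul_def, map_ofNat]
  have h3 : (3 : R) * x = (3 : ℂ) • x := by rw [Algebra.smul_def, map_ofNat]
  rw [h2, h3]
  constructor
  · intro h
    rw [← inv_smul_smul₀ (two_ne_zero (α := ℂ)) y, h, smul_smul]
    norm_num
  · rintro rfl
    rw [smul_smul]
    norm_num

theorem brauerTriple_brauerGen :
    BrauerTriple (brauerGen .e0) (brauerGen .e1) (brauerGen .s1) := by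
  have h1 := RingQuot.mkAlgHom_rel ℂ OneBoundaryBrauerRel.e0_sq
  have h2 := RingQuot.mkAlgHom_rel ℂ OneBoundaryBrauerRel.s1_sq
  have h3 := RingQuot.mkAlgHom_rel ℂ OneBoundaryBrauerRel.e1_sq
  have h4 := RingQuot.mkAlgHom_rel ℂ OneBoundaryBrauerRel.s1_e1
  have h5 := RingQuot.mkAlgHom_rel ℂ OneBoundaryBrauerRel.e1_s1
  have h6 := RingQuot.mkAlgHom_rel ℂ OneBoundaryBrauerRel.e1_e0_s1
  have h7 := RingQuot.mkAlgHom_rel ℂ OneBoundaryBrauerRel.s1_e0_e1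
  have h8 := RingQuot.mkAlgHom_rel ℂ OneBoundaryBrauerRel.e0_s1_e0
  have h9 := RingQuot.mkAlgHom_rel ℂ OneBoundaryBrauerRel.e0_e1_e0
  simp only [anticomm, map_mul, map_add, map_sub, map_pow, map_one, map_ofNat, map_smul, map_neg]
    at h1 h2 h3 h4 h5 h6 h7 h8 h9
  rw [pow_two] at h1 h2 h3
  refine ⟨?_, h2, h3, h4, h5, h6, h7, h8, h9⟩
  exact two_mul_eq_three_mul_iff.mpr h1

theorem exists_oneBoundaryBrauer_hom {e f s : R} (h : BrauerTriple e f s) :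
    ∃ F : OneBoundaryBrauer →ₐ[ℂ] R,
      F (brauerGen .e0) = e ∧ F (brauerGen .e1) = f ∧ F (brauerGen .s1) = s := by
  let g : BrauerGen → R := fun x => BrauerGen.rec e f s x
  have h0 : FreeAlgebra.lift ℂ g (freeBrauer .e0) = e := FreeAlgebra.lift_ι_apply _ _
  have h1 : FreeAlgebra.lift ℂ g (freeBrauer .e1) = f := FreeAlgebra.lift_ι_apply _ _
  have h2 : FreeAlgebra.lift ℂ g (freeBrauer .s1) = s := FreeAlgebra.lift_ι_apply _ _
  refine ⟨RingQuot.liftAlgHom ℂ ⟨FreeAlgebra.lift ℂ g, fun x y hxy => ?_⟩, ?_, ?_, ?_⟩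
  · cases hxy <;>
      simp only [anticomm, map_mul, map_add, map_sub, map_one, map_ofNat, map_neg,
        map_smul, h0, h1, h2, pow_two]
    exacts [two_mul_eq_three_mul_iff.mp h.e_sq, h.s_sq, h.f_sq, h.s_f, h.f_s, h.f_e_s, h.s_e_f, h.e_s_e, h.e_f_e]
  · rw [brauerGen, RingQuot.liftAlgHom_mkAlgHom_apply, h0]
  · rw [brauerGen, RingQuot.liftAlgHom_mkAlgHom_apply, h1]
  · rw [brauerGen, RingQuot.liftAlgHom_mkAlgHom_apply, h2]

end Lifts

/-! ### The simplified algebra is the one-boundary Brauer algebra -/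

section Brauer

theorem mem_of_ofNat_mul_mem {R : Type*} [Ring R] [Algebra ℂ R] (S : Subalgebra ℂ R) (n : ℕ)
    [n.AtLeastTwo] {x : R} (h : (OfNat.ofNat n : R) * x ∈ S) : x ∈ S := by
  have hn : (OfNat.ofNat n : R) = algebraMap ℂ R (OfNat.ofNat n) := by rw [map_ofNat]
  rw [hn, ← Algebra.smul_def] at h
  have h' := S.smul_mem h (OfNat.ofNat n : ℂ)⁻¹
  rwa [inv_smul_smul₀ (OfNat.ofNat_ne_zero n)] at h'

theorem exists_simplifiedAlgebra_equiv_oneBoundaryBrauer :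
    ∃ f : SimplifiedAlgebra ≃ₐ[ℂ] OneBoundaryBrauer,
      f (simplifiedGen .A) = 4 - 2 * brauerGen .e0 ∧
      f (simplifiedGen .B) = 2 * (brauerGen .s1 - brauerGen .e1) + 4 := by
  have hbr := brauerTriple_brauerGen
  obtain ⟨f, hA, hB⟩ := exists_simplifiedAlgebra_hom hbr.simplifiedPair
  obtain ⟨g, h0, h1, h2⟩ := exists_oneBoundaryBrauer_hom brauerTriple_block
  have hgA : g (4 - 2 * brauerGen .e0) = blockA := by
    simp only [map_sub, map_mul, map_ofNat, h0, blockA, blockE0]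
    refine Prod.ext ?_ (Prod.ext ?_ ?_) <;>
    simp only [Prod.fst_mul, Prod.snd_mul, Prod.fst_sub, Prod.snd_sub, Prod.fst_ofNat,
      Prod.snd_ofNat, ofNat_fin_two, Matrix.mul_fin_two] <;>
    norm_num [← Matrix.ext_iff, Fin.forall_fin_two, eq_iff_true_of_subsingleton]
  have hgB : g (2 * (brauerGen .s1 - brauerGen .e1) + 4) = blockB := by
    simp only [map_sub, map_mul, map_add, map_ofNat, h1, h2, blockB, blockS1, blockE1]
    refine Prod.ext ?_ (Prod.ext ?_ ?_) <;>
    simp only [Prod.fst_mul, Prod.snd_mul, Prod.fst_sub, Prod.snd_sub, Prod.fst_add, Prod.snd_add,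
      Prod.fst_ofNat, Prod.snd_ofNat, ofNat_fin_two] <;>
    norm_num [← Matrix.ext_iff, Fin.forall_fin_two]
  -- The composite `g ∘ f` sends the generators to `blockA` and `blockB`, which already makes it
  -- injective.
  have hinj : Function.Injective f := by
    refine Function.Injective.of_comp (f := g) ?_
    have := injective_of_simplifiedGen (f := g.comp f) (by simp [hA, hgA]) (by simp [hB, hgB])
    simpa using this
  have mA : 4 - 2 * brauerGen .e0 ∈ f.range := ⟨_, hA⟩
  have mB : 2 * (brauerGen .s1 - brauerGen .e1) + 4 ∈ f.range := ⟨_, hB⟩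
  have m0 : brauerGen .e0 ∈ f.range := by
    refine mem_of_ofNat_mul_mem _ 2 ?_
    have : 2 * brauerGen .e0 = 4 - (4 - 2 * brauerGen .e0) := by abel
    rw [this]
    exact sub_mem (ofNat_mem _ 4) mA
  -- The relations give `(s₁ - e₁)² = 1 + e₁`, so the square of the image of `B - 4` is `4 + 4e₁`
  -- and isolates `e₁`; then `s₁` follows by addition.
  have m1 : brauerGen .e1 ∈ f.range := by
    refine mem_of_ofNat_mul_mem _ 4 ?_
    have : 4 * brauerGen .e1 = (2 * (brauerGen .s1 - brauerGen .e1) + 4 - 4) *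
        (2 * (brauerGen .s1 - brauerGen .e1) + 4 - 4) - 4 := by
      linear_combination (norm := grind)
        -4 * hbr.s_sq + 4 * hbr.s_f + 4 * hbr.f_s - 4 * hbr.f_sq
    rw [this]
    exact sub_mem (mul_mem (sub_mem mB (ofNat_mem _ 4)) (sub_mem mB (ofNat_mem _ 4)))
      (ofNat_mem _ 4)
  have m2 : brauerGen .s1 ∈ f.range := by
    refine mem_of_ofNat_mul_mem _ 2 ?_
    have : 2 * brauerGen .s1 = (2 * (brauerGen .s1 - brauerGen .e1) + 4) - 4 + 2 * brauerGen .e1 := by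
      linear_combination (norm := grind)
    rw [this]
    exact add_mem (sub_mem mB (ofNat_mem _ 4)) (mul_mem (ofNat_mem _ 2) m1)
  have hsurj : Function.Surjective f := by
    rw [← AlgHom.range_eq_top, eq_top_iff,
      ← adjoin_map_eq_top _ (RingQuot.mkAlgHom_surjective ℂ OneBoundaryBrauerRel)]
    refine Algebra.adjoin_le ?_
    rintro _ ⟨x, rfl⟩
    cases x
    exacts [m0, m1, m2]
  exact ⟨AlgEquiv.ofBijective f ⟨hinj, hsurj⟩, hA, hB⟩

end Brauer

/-! ### From the simplified algebra onto the quotiented Racah algebra -/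

section Racah

open RacahGen

/-- The composite projection from the free algebra onto the quotiented Racah algebra. -/
noncomputable def quotRacahProj (n₁ n₂ n₃ : ℕ) :
    FreeAlgebra ℂ RacahGen →ₐ[ℂ] QuotientedRacah n₁ n₂ n₃ :=
  (RingQuot.mkAlgHom ℂ (QuotientedRacahRel n₁ n₂ n₃)).comp (RingQuot.mkAlgHom ℂ UniversalRacahRel)

theorem quotRacahProj_freeRacah (n₁ n₂ n₃ : ℕ) (g : RacahGen) :
    quotRacahProj n₁ n₂ n₃ (freeRacah g) = quotRacahGen n₁ n₂ n₃ g := rfl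

theorem quotRacahProj_rel (n₁ n₂ n₃ : ℕ) {x y : FreeAlgebra ℂ RacahGen}
    (h : UniversalRacahRel x y) : quotRacahProj n₁ n₂ n₃ x = quotRacahProj n₁ n₂ n₃ y := by
  simp only [quotRacahProj, AlgHom.comp_apply, RingQuot.mkAlgHom_rel ℂ h]

theorem quotRacahProj_surjective (n₁ n₂ n₃ : ℕ) :
    Function.Surjective (quotRacahProj n₁ n₂ n₃) :=
  (RingQuot.mkAlgHom_surjective ℂ _).comp (RingQuot.mkAlgHom_surjective ℂ _)

theorem casimirValue_one : casimirValue 1 = 3 / 4 := by norm_num [casimirValue]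

theorem casimirValue_two : casimirValue 2 = 2 := by norm_num [casimirValue]

theorem quotRacahGen_alpha_zero :
    quotRacahGen 1 2 2 (alpha 0) = algebraMap ℂ (QuotientedRacah 1 2 2) (3 / 4) := by
  have h := RingQuot.mkAlgHom_rel ℂ (QuotientedRacahRel.alpha1 (n₁ := 1) (n₂ := 2) (n₃ := 2))
  rw [AlgHom.commutes, casimirValue_one] at h
  rw [quotRacahGen, h]
  norm_num

theorem quotRacahGen_alpha_one :
    quotRacahGen 1 2 2 (alpha 1) = algebraMap ℂ (QuotientedRacah 1 2 2) 2 := by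
  have h := RingQuot.mkAlgHom_rel ℂ (QuotientedRacahRel.alpha2 (n₁ := 1) (n₂ := 2) (n₃ := 2))
  rw [AlgHom.commutes, casimirValue_two] at h
  rw [quotRacahGen, h]
  norm_num

theorem quotRacahGen_alpha_two :
    quotRacahGen 1 2 2 (alpha 2) = algebraMap ℂ (QuotientedRacah 1 2 2) 2 := by
  have h := RingQuot.mkAlgHom_rel ℂ (QuotientedRacahRel.alpha3 (n₁ := 1) (n₂ := 2) (n₃ := 2))
  rw [AlgHom.commutes, casimirValue_two] at h
  rw [quotRacahGen, h]
  norm_num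

/-- Since `j(j+1) + 1/4 = (j + 1/2)²`, the shift turns the values `3/4, 15/4, 35/4` into the squares
`1, 4, 9`. The element `t` plays the part of `1/4`, so that all identities have integer
coefficients. -/
theorem racahTriple_add_quarter {R : Type*} [Ring R] {A B C t : R} (ht : 4 * t = 1)
    (tA : t * A = A * t) (tB : t * B = B * t) (tC : t * C = C * t)
    (hCA : C * A = A * C) (hCB : C * B = B * C)
    (hR : A * (B * A - A * B) - (B * A - A * B) * A =
      -2 * A ^ 2 - 2 * (A * B + B * A) + 2 * (C + 3 * t + 2 + 2) * A + 2 * (3 * t - 2) * (2 - C))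
    (hA : (A - 15 * t) * (A - 3 * t) = 0) (hB : (B - 6) * ((B - 2) * B) = 0)
    (hC : (C - 35 * t) * ((C - 15 * t) * (C - 3 * t)) = 0)
    (h13 : (C - A - B + 3 * t + 2 + 2 - 15 * t) * (C - A - B + 3 * t + 2 + 2 - 3 * t) = 0) :
    RacahTriple (A + t) B (C + t) := by
  constructor
  · linear_combination (norm := grind) hCA + tA - tC
  · linear_combination (norm := grind) hCB + tB
  · linear_combination (norm := grind)
      -t * tB + tB * t + 2 * tB * A + B * tA - tA * B + hR - 2 * ht * C + 2 * ht * A - 2 * A * tB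
        - 2 * tB + 2 * tC + ht * B - 2 * tA
  · have e1 : A - 15 * t = A + t - 4 := by linear_combination (norm := grind) -4 * ht
    have e2 : A - 3 * t = A + t - 1 := by linear_combination (norm := grind) -ht
    rw [e1, e2] at hA
    linear_combination (norm := grind) hA
  · linear_combination (norm := grind) hB
  · have e1 : C - 15 * t = C + t - 4 := by linear_combination (norm := grind) -4 * ht
    have e2 : C - 3 * t = C + t - 1 := by linear_combination (norm := grind) -ht
    have e3 : C - 35 * t = C + t - 9 := by linear_combination (norm := grind) -9 * ht
    rw [e1, e2, e3] at hC
    linear_combination (norm := grind) hC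
  · have e1 : C - A - B + 3 * t + 2 + 2 - 15 * t = C + t - (A + t) - B + 1 := by
      linear_combination (norm := grind) -3 * ht
    have e2 : C - A - B + 3 * t + 2 + 2 - 3 * t = C + t - (A + t) - B + 4 := by
      linear_combination (norm := grind)
    rw [e1, e2] at h13
    exact h13

/-- Centrality of `C`, the relation `racah_A` and the annihilating polynomials of `A`, `B`, `C` and
of the element for the pair 13 suffice, once the `αᵢ` are replaced by their values. -/
theorem racahTriple_quotRacahGen :
    RacahTriple (quotRacahGen 1 2 2 .A + algebraMap ℂ _ (1 / 4)) (quotRacahGen 1 2 2 .B)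
      (quotRacahGen 1 2 2 .C + algebraMap ℂ _ (1 / 4)) := by
  have hCA := quotRacahProj_rel 1 2 2 (.central_C A)
  have hCB := quotRacahProj_rel 1 2 2 (.central_C B)
  have hR := quotRacahProj_rel 1 2 2 .racah_A
  have hA := RingQuot.mkAlgHom_rel ℂ (QuotientedRacahRel.char_A (n₁ := 1) (n₂ := 2) (n₃ := 2))
  have hB := RingQuot.mkAlgHom_rel ℂ (QuotientedRacahRel.char_B (n₁ := 1) (n₂ := 2) (n₃ := 2))
  have hC := RingQuot.mkAlgHom_rel ℂ (QuotientedRacahRel.char_C (n₁ := 1) (n₂ := 2) (n₃ := 2))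
  have h13 := RingQuot.mkAlgHom_rel ℂ (QuotientedRacahRel.char_13 (n₁ := 1) (n₂ := 2) (n₃ := 2))
  set t : QuotientedRacah 1 2 2 := algebraMap ℂ _ (1 / 4) with ht'
  have ht : 4 * t = 1 := by
    rw [ht', ← map_ofNat (algebraMap ℂ (QuotientedRacah 1 2 2)) 4, ← map_mul]
    norm_num
  have hmul : ∀ n : ℂ, algebraMap ℂ (QuotientedRacah 1 2 2) (n / 4) = algebraMap ℂ _ n * t := by
    intro n
    rw [ht', ← map_mul, mul_one_div]
  have tc : ∀ x, t * x = x * t := fun x => Algebra.commutes _ x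
  simp only [quotRacahProj_freeRacah, Ring.lie_def, anticomm, map_mul, map_add, map_sub, map_neg,
    map_pow, map_ofNat, quotRacahGen_alpha_zero, quotRacahGen_alpha_one, quotRacahGen_alpha_two,
    hmul] at hCA hCB hR
  have hch : ∀ s x, RingQuot.mkAlgHom ℂ (QuotientedRacahRel 1 2 2) (charProduct s x) =
      charProduct s (RingQuot.mkAlgHom ℂ (QuotientedRacahRel 1 2 2) x) :=
    fun s x => (Polynomial.aeval_algHom_apply _ x _).symm
  rw [hch, map_zero, charProduct_pairValues_one_two, hmul, hmul, map_ofNat, map_ofNat] at hA h13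
  rw [hch, map_zero, charProduct_pairValues_two_two, map_ofNat, map_ofNat] at hB
  rw [hch, map_zero, charProduct_tripleValues_one_two_two, hmul, hmul, hmul, map_ofNat, map_ofNat,
    map_ofNat] at hC
  simp only [map_add, map_sub] at h13
  -- By definition `quotRacahGen` is the image of `racahGen` under the second quotient map.
  change (quotRacahGen 1 2 2 .A - _) * (quotRacahGen 1 2 2 .A - _) = 0 at hA
  change (quotRacahGen 1 2 2 .B - _) * ((quotRacahGen 1 2 2 .B - _) * quotRacahGen 1 2 2 .B) = 0
    at hB
  change (quotRacahGen 1 2 2 .C - _) * ((quotRacahGen 1 2 2 .C - _) *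
    (quotRacahGen 1 2 2 .C - _)) = 0 at hC
  change (quotRacahGen 1 2 2 .C - quotRacahGen 1 2 2 .A - quotRacahGen 1 2 2 .B
    + quotRacahGen 1 2 2 (alpha 0) + quotRacahGen 1 2 2 (alpha 1) + quotRacahGen 1 2 2 (alpha 2)
      - _) * (quotRacahGen 1 2 2 .C - quotRacahGen 1 2 2 .A - quotRacahGen 1 2 2 .B
    + quotRacahGen 1 2 2 (alpha 0) + quotRacahGen 1 2 2 (alpha 1) + quotRacahGen 1 2 2 (alpha 2)
      - _) = 0 at h13
  simp only [quotRacahGen_alpha_zero, quotRacahGen_alpha_one, quotRacahGen_alpha_two,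
    hmul, map_ofNat] at h13
  exact racahTriple_add_quarter ht (tc _) (tc _) (tc _) hCA hCB hR hA hB hC h13

theorem exists_simplifiedAlgebra_hom_quotientedRacah :
    ∃ f : SimplifiedAlgebra →ₐ[ℂ] QuotientedRacah 1 2 2, Function.Surjective f ∧
      f (simplifiedGen .A) = quotRacahGen 1 2 2 .A + algebraMap ℂ _ (1 / 4) ∧
      f (simplifiedGen .B) = quotRacahGen 1 2 2 .B := by
  have h := racahTriple_quotRacahGen
  obtain ⟨f, hA, hB⟩ := exists_simplifiedAlgebra_hom h.simplifiedPair
  refine ⟨f, ?_, hA, hB⟩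
  -- The preimage of `C + 1/4` is read off from `RacahTriple.four_mul`; the `αᵢ` are scalars, so all
  -- generators are reached.
  have hC : f ((1 / 4 : ℂ) • ((simplifiedGen .A * simplifiedGen .B
      + simplifiedGen .B * simplifiedGen .A - 5 * simplifiedGen .B) * (simplifiedGen .A - 2))) =
      quotRacahGen 1 2 2 .C + algebraMap ℂ _ (1 / 4) := by
    simp only [map_smul, map_mul, map_add, map_sub, map_ofNat, hA, hB]
    rw [← h.four_mul, ← map_ofNat (algebraMap ℂ (QuotientedRacah 1 2 2)) 4, ← Algebra.smul_def,
      smul_smul]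
    norm_num
  have hgen : ∀ g, ∃ y, f y = quotRacahGen 1 2 2 g := by
    intro g
    rcases g with _ | _ | _ | i
    · exact ⟨simplifiedGen .A - algebraMap ℂ _ (1 / 4), by rw [map_sub, hA, AlgHom.commutes]; abel⟩
    · exact ⟨_, hB⟩
    · exact ⟨_ - algebraMap ℂ _ (1 / 4), by rw [map_sub, hC, AlgHom.commutes]; abel⟩
    · fin_cases i
      · exact ⟨_, (f.commutes _).trans quotRacahGen_alpha_zero.symm⟩
      · exact ⟨_, (f.commutes _).trans quotRacahGen_alpha_one.symm⟩
      · exact ⟨_, (f.commutes _).trans quotRacahGen_alpha_two.symm⟩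
  intro q
  obtain ⟨x, rfl⟩ := quotRacahProj_surjective 1 2 2 q
  induction x using FreeAlgebra.induction with
  | grade0 r => exact ⟨algebraMap ℂ _ r, by rw [AlgHom.commutes, AlgHom.commutes]⟩
  | grade1 g => exact hgen g
  | mul x y hx hy =>
    obtain ⟨u, hu⟩ := hx
    obtain ⟨v, hv⟩ := hy
    exact ⟨u * v, by rw [map_mul, map_mul, hu, hv]⟩
  | add x y hx hy =>
    obtain ⟨u, hu⟩ := hx
    obtain ⟨v, hv⟩ := hy
    exact ⟨u + v, by rw [map_add, map_add, hu, hv]⟩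

end Racah

/-! ### The Racah relations in the block algebra -/

section BlockRacah

open RacahGen

/-- The image of `A` in the block algebra. -/
noncomputable def blockK12 : BlockAlgebra :=
  (!![7 / 4, 1; 2, 11 / 4], !![11 / 4, 2; 1, 7 / 4], 15 / 4)

/-- The image of `C` in the block algebra. -/
noncomputable def blockK123 : BlockAlgebra :=
  (!![3 / 4, 0; 0, 3 / 4], !![15 / 4, 0; 0, 15 / 4], 35 / 4)

theorem algebraMap_block (r : ℂ) :
    algebraMap ℂ BlockAlgebra r = (!![r, 0; 0, r], !![r, 0; 0, r], r) := by
  refine Prod.ext ?_ (Prod.ext ?_ ?_)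
  · ext i j
    fin_cases i <;> fin_cases j <;> simp [Matrix.algebraMap_matrix_apply]
  · ext i j
    fin_cases i <;> fin_cases j <;> simp [Matrix.algebraMap_matrix_apply]
  · simp

theorem blockK12_add : blockK12 + algebraMap ℂ BlockAlgebra (1 / 4) = blockA := by
  rw [algebraMap_block]
  norm_num [blockA, blockK12, Prod.ext_iff, ← Matrix.ext_iff, Fin.forall_fin_two]

theorem ofNat_block (n : ℕ) [n.AtLeastTwo] : (OfNat.ofNat n : BlockAlgebra) =
    (!![OfNat.ofNat n, 0; 0, OfNat.ofNat n], !![OfNat.ofNat n, 0; 0, OfNat.ofNat n],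
      OfNat.ofNat n) := by
  rw [← ofNat_fin_two]
  rfl

theorem block_racah_B : ⁅blockB, ⁅blockK12, blockB⁆⁆ = -2 * blockB ^ 2 - 2 * anticomm blockK12 blockB
    + 2 * (blockK123 + algebraMap ℂ _ (3 / 4) + algebraMap ℂ _ 2 + algebraMap ℂ _ 2) * blockB
    + 2 * (algebraMap ℂ _ (3 / 4) - blockK123) * (algebraMap ℂ _ 2 - algebraMap ℂ _ 2) := by
  simp only [algebraMap_block, ofNat_block, Ring.lie_def, anticomm, blockB, blockK12, blockK123,
    pow_two]
  refine Prod.ext ?_ (Prod.ext ?_ ?_) <;>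
  simp only [Prod.mk_mul_mk, Prod.mk_add_mk, Prod.mk_sub_mk, Prod.neg_mk, Matrix.mul_fin_two] <;>
  norm_num [← Matrix.ext_iff, Fin.forall_fin_two, eq_iff_true_of_subsingleton]

theorem block_racah_A : ⁅blockK12, ⁅blockB, blockK12⁆⁆ =
    -2 * blockK12 ^ 2 - 2 * anticomm blockK12 blockB
    + 2 * (blockK123 + algebraMap ℂ _ (3 / 4) + algebraMap ℂ _ 2 + algebraMap ℂ _ 2) * blockK12
    + 2 * (algebraMap ℂ _ (3 / 4) - algebraMap ℂ _ 2) * (algebraMap ℂ _ 2 - blockK123) := by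
  simp only [algebraMap_block, ofNat_block, Ring.lie_def, anticomm, blockB, blockK12, blockK123,
    pow_two]
  refine Prod.ext ?_ (Prod.ext ?_ ?_) <;>
  simp only [Prod.mk_mul_mk, Prod.mk_add_mk, Prod.mk_sub_mk, Prod.neg_mk, Matrix.mul_fin_two] <;>
  norm_num [← Matrix.ext_iff, Fin.forall_fin_two, eq_iff_true_of_subsingleton]

theorem blockK123_comm (x : BlockAlgebra) : blockK123 * x = x * blockK123 := by
  have h (r : ℂ) (m : Matrix (Fin 2) (Fin 2) ℂ) : !![r, 0; 0, r] * m = m * !![r, 0; 0, r] := by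
    ext i j
    fin_cases i <;> fin_cases j <;> simp [Matrix.mul_apply, mul_comm]
  exact Prod.ext (h _ _) (Prod.ext (h _ _) (mul_comm _ _))

theorem charProduct_blockK12 : charProduct (pairValues 1 2) blockK12 = 0 := by
  rw [charProduct_pairValues_one_two]
  simp only [algebraMap_block, blockK12]
  refine Prod.ext ?_ (Prod.ext ?_ ?_) <;>
  norm_num [← Matrix.ext_iff, Fin.forall_fin_two, eq_iff_true_of_subsingleton]

theorem charProduct_blockB : charProduct (pairValues 2 2) blockB = 0 := by
  rw [charProduct_pairValues_two_two]
  simp only [algebraMap_block, blockB]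
  refine Prod.ext ?_ (Prod.ext ?_ ?_) <;>
  norm_num [← Matrix.ext_iff, Fin.forall_fin_two, eq_iff_true_of_subsingleton]

theorem charProduct_blockK123 : charProduct (tripleValues 1 2 2) blockK123 = 0 := by
  rw [charProduct_tripleValues_one_two_two]
  simp only [algebraMap_block, blockK123]
  refine Prod.ext ?_ (Prod.ext ?_ ?_) <;>
  norm_num [← Matrix.ext_iff, Fin.forall_fin_two, eq_iff_true_of_subsingleton]

theorem charProduct_block13 : charProduct (pairValues 1 2) (blockK123 - blockK12 - blockB
    + algebraMap ℂ _ (3 / 4) + algebraMap ℂ _ 2 + algebraMap ℂ _ 2) = 0 := by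
  rw [charProduct_pairValues_one_two]
  simp only [algebraMap_block, blockK12, blockB, blockK123]
  refine Prod.ext ?_ (Prod.ext ?_ ?_) <;>
  norm_num [← Matrix.ext_iff, Fin.forall_fin_two, eq_iff_true_of_subsingleton]

theorem charProduct_blockK12_add_blockB : charProduct (edgeValues 1 2 2) (blockK12 + blockB
    - algebraMap ℂ _ (3 / 4) - algebraMap ℂ _ 2 - algebraMap ℂ _ 2) = 0 := by
  rw [charProduct_edgeValues_one_two_two]
  simp only [algebraMap_block, blockK12, blockB]
  refine Prod.ext ?_ (Prod.ext ?_ ?_) <;>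
  norm_num [← Matrix.ext_iff, Fin.forall_fin_two, eq_iff_true_of_subsingleton]

theorem charProduct_blockK123_sub_blockK12 :
    charProduct (edgeValues 1 2 2) (blockK123 - blockK12) = 0 := by
  rw [charProduct_edgeValues_one_two_two]
  simp only [algebraMap_block, blockK12, blockK123]
  refine Prod.ext ?_ (Prod.ext ?_ ?_) <;>
  norm_num [← Matrix.ext_iff, Fin.forall_fin_two, eq_iff_true_of_subsingleton]

theorem charProduct_blockK123_sub_blockB :
    charProduct (edgeValues 2 2 1) (blockK123 - blockB) = 0 := by
  rw [charProduct_edgeValues_two_two_one]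
  simp only [algebraMap_block, blockB, blockK123]
  refine Prod.ext ?_ (Prod.ext ?_ ?_) <;>
  norm_num [← Matrix.ext_iff, Fin.forall_fin_two, eq_iff_true_of_subsingleton]

variable {E : Type*} [Ring E] [Algebra ℂ E]

/-- As `ρ` is injective, a relation holds in `E` once it holds between block matrices. This spares
any computation with operators on the 18-dimensional tensor product beyond the images of the three
Casimirs. -/
theorem exists_quotientedRacah_hom (ρ : E →ₐ[ℂ] BlockAlgebra) (hρ : Function.Injective ρ)
    {A B C : E} (hA : ρ A = blockK12) (hB : ρ B = blockB) (hC : ρ C = blockK123) :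
    ∃ F : QuotientedRacah 1 2 2 →ₐ[ℂ] E, F (quotRacahGen 1 2 2 .A) = A ∧
      F (quotRacahGen 1 2 2 .B) = B ∧ F (quotRacahGen 1 2 2 .C) = C := by
  let α : Fin 3 → E := ![algebraMap ℂ E (3 / 4), algebraMap ℂ E 2, algebraMap ℂ E 2]
  let g : RacahGen → E := fun x => RacahGen.rec A B C α x
  have gA : FreeAlgebra.lift ℂ g (freeRacah .A) = A := FreeAlgebra.lift_ι_apply _ _
  have gB : FreeAlgebra.lift ℂ g (freeRacah .B) = B := FreeAlgebra.lift_ι_apply _ _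
  have gC : FreeAlgebra.lift ℂ g (freeRacah .C) = C := FreeAlgebra.lift_ι_apply _ _
  have gα (i) : FreeAlgebra.lift ℂ g (freeRacah (.alpha i)) = α i := FreeAlgebra.lift_ι_apply _ _
  have α0 : ρ (α 0) = algebraMap ℂ _ (3 / 4) := ρ.commutes _
  have α1 : ρ (α 1) = algebraMap ℂ _ 2 := ρ.commutes _
  have α2 : ρ (α 2) = algebraMap ℂ _ 2 := ρ.commutes _
  have hα (i) (x : E) : α i * x = x * α i := by
    fin_cases i <;> exact Algebra.commutes _ _
  -- Two lifts are needed, since the quotiented algebra is a quotient of the universal Racah algebra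
  -- and not directly of the free algebra.
  obtain ⟨G, hG⟩ : ∃ G : UniversalRacah →ₐ[ℂ] E,
      ∀ x, G (RingQuot.mkAlgHom ℂ UniversalRacahRel x) = FreeAlgebra.lift ℂ g x := by
    refine ⟨RingQuot.liftAlgHom ℂ ⟨FreeAlgebra.lift ℂ g, fun x y hxy => hρ ?_⟩,
      fun x => RingQuot.liftAlgHom_mkAlgHom_apply _ _ _ _⟩
    cases hxy with
    | central_C x => simp only [map_mul, gC, hC]; rw [blockK123_comm]
    | central_alpha i x => exact congrArg ρ (by rw [map_mul, map_mul, gα, hα])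
    | racah_B =>
      simp only [Ring.lie_def, anticomm, map_mul, map_add, map_sub, map_neg, map_pow, map_ofNat,
        gA, gB, gC, gα, hA, hB, hC, α0, α1, α2]
      simpa only [Ring.lie_def, anticomm, map_ofNat] using block_racah_B
    | racah_A =>
      simp only [Ring.lie_def, anticomm, map_mul, map_add, map_sub, map_neg, map_pow, map_ofNat,
        gA, gB, gC, gα, hA, hB, hC, α0, α1, α2]
      simpa only [Ring.lie_def, anticomm, map_ofNat] using block_racah_A
  have GA : G (racahGen .A) = A := (hG _).trans gA
  have GB : G (racahGen .B) = B := (hG _).trans gB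
  have GC : G (racahGen .C) = C := (hG _).trans gC
  have Gα (i) : G (racahGen (.alpha i)) = α i := (hG _).trans (gα i)
  have hch (s x) : ρ (G (charProduct s x)) = charProduct s (ρ (G x)) := by
    rw [← map_charProduct]
    exact congrArg ρ (Polynomial.aeval_algHom_apply G x _).symm
  refine ⟨RingQuot.liftAlgHom ℂ ⟨G, fun x y hxy => hρ ?_⟩, ?_, ?_, ?_⟩
  · cases hxy with
    | alpha1 => rw [Gα, α0, AlgHom.commutes, AlgHom.commutes, casimirValue_one]; norm_num
    | alpha2 => rw [Gα, α1, AlgHom.commutes, AlgHom.commutes, casimirValue_two]; norm_num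
    | alpha3 => rw [Gα, α2, AlgHom.commutes, AlgHom.commutes, casimirValue_two]; norm_num
    | char_A => rw [hch, GA, hA, charProduct_blockK12, map_zero, map_zero]
    | char_B => rw [hch, GB, hB, charProduct_blockB, map_zero, map_zero]
    | char_C => rw [hch, GC, hC, charProduct_blockK123, map_zero, map_zero]
    | char_13 =>
      rw [hch, map_zero, map_zero]
      simp only [map_add, map_sub, GA, GB, GC, Gα, hA, hB, hC, α0, α1, α2]
      exact charProduct_block13
    | char_A_add_B =>
      rw [hch, map_zero, map_zero]
      simp only [map_add, map_sub, GA, GB, Gα, hA, hB, α0, α1, α2]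
      exact charProduct_blockK12_add_blockB
    | char_C_sub_A =>
      rw [hch, map_zero, map_zero, map_sub, map_sub, GA, GC, hA, hC]
      exact charProduct_blockK123_sub_blockK12
    | char_C_sub_B =>
      rw [hch, map_zero, map_zero, map_sub, map_sub, GB, GC, hB, hC]
      exact charProduct_blockK123_sub_blockB
  · rw [quotRacahGen, RingQuot.liftAlgHom_mkAlgHom_apply, GA]
  · rw [quotRacahGen, RingQuot.liftAlgHom_mkAlgHom_apply, GB]
  · rw [quotRacahGen, RingQuot.liftAlgHom_mkAlgHom_apply, GC]

end BlockRacah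

/-! ### Operators on tensor factors; the Casimirs lie in the centralizer -/

section SiteOperators

open TensorProduct

variable (n₁ n₂ n₃ : ℕ)

/-- An operator given on every spin space, acting on one factor of the threefold tensor product. -/
noncomputable def siteMap (a : Fin 3) (f : ∀ n, Module.End ℂ (SpinSpace n)) :
    Module.End ℂ (SpinTensor n₁ n₂ n₃) :=
  ![map (f n₁) LinearMap.id, map LinearMap.id (map (f n₂) LinearMap.id),
    map LinearMap.id (map LinearMap.id (f n₃))] a

variable {n₁ n₂ n₃}

theorem siteMap_zero_tmul (f : ∀ n, Module.End ℂ (SpinSpace n)) (u : SpinSpace n₁)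
    (v : SpinSpace n₂) (w : SpinSpace n₃) :
    siteMap n₁ n₂ n₃ 0 f (u ⊗ₜ (v ⊗ₜ w)) = f n₁ u ⊗ₜ (v ⊗ₜ w) := rfl

theorem siteMap_one_tmul (f : ∀ n, Module.End ℂ (SpinSpace n)) (u : SpinSpace n₁)
    (v : SpinSpace n₂) (w : SpinSpace n₃) :
    siteMap n₁ n₂ n₃ 1 f (u ⊗ₜ (v ⊗ₜ w)) = u ⊗ₜ (f n₂ v ⊗ₜ w) := rfl

theorem siteMap_two_tmul (f : ∀ n, Module.End ℂ (SpinSpace n)) (u : SpinSpace n₁)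
    (v : SpinSpace n₂) (w : SpinSpace n₃) :
    siteMap n₁ n₂ n₃ 2 f (u ⊗ₜ (v ⊗ₜ w)) = u ⊗ₜ (v ⊗ₜ f n₃ w) := rfl

theorem spinTensor_ext {X Y : Module.End ℂ (SpinTensor n₁ n₂ n₃)}
    (h : ∀ u v w, X (u ⊗ₜ (v ⊗ₜ w)) = Y (u ⊗ₜ (v ⊗ₜ w))) : X = Y := by
  refine TensorProduct.ext' fun u y => ?_
  induction y using TensorProduct.induction_on with
  | zero => simp
  | tmul v w => exact h u v w
  | add y z hy hz => rw [tmul_add, map_add, map_add, hy, hz]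

theorem siteMap_add (a : Fin 3) (f g : ∀ n, Module.End ℂ (SpinSpace n)) :
    siteMap n₁ n₂ n₃ a (f + g) = siteMap n₁ n₂ n₃ a f + siteMap n₁ n₂ n₃ a g := by
  refine spinTensor_ext fun u v w => ?_
  fin_cases a <;>
  simp [siteMap_zero_tmul, siteMap_one_tmul, siteMap_two_tmul, tmul_add, add_tmul]

theorem siteMap_smul (a : Fin 3) (c : ℂ) (f : ∀ n, Module.End ℂ (SpinSpace n)) :
    siteMap n₁ n₂ n₃ a (c • f) = c • siteMap n₁ n₂ n₃ a f := by
  refine spinTensor_ext fun u v w => ?_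
  fin_cases a <;>
  simp [siteMap_zero_tmul, siteMap_one_tmul, siteMap_two_tmul, tmul_smul, ← smul_tmul']

theorem siteMap_lie_same (a : Fin 3) (f g : ∀ n, Module.End ℂ (SpinSpace n)) :
    ⁅siteMap n₁ n₂ n₃ a f, siteMap n₁ n₂ n₃ a g⁆ = siteMap n₁ n₂ n₃ a fun n => ⁅f n, g n⁆ := by
  refine spinTensor_ext fun u v w => ?_
  fin_cases a <;>
  simp [Ring.lie_def, siteMap_zero_tmul, siteMap_one_tmul, siteMap_two_tmul, tmul_sub, sub_tmul]

theorem siteMap_lie_of_ne {a b : Fin 3} (hab : a ≠ b) (f g : ∀ n, Module.End ℂ (SpinSpace n)) :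
    ⁅siteMap n₁ n₂ n₃ a f, siteMap n₁ n₂ n₃ b g⁆ = 0 := by
  refine spinTensor_ext fun u v w => ?_
  fin_cases a <;> fin_cases b <;>
  first
  | exact absurd rfl hab
  | simp [Ring.lie_def, siteMap_zero_tmul, siteMap_one_tmul, siteMap_two_tmul]

variable (n₁ n₂ n₃)

/-- An operator given on every spin space, acting diagonally on a set of tensor factors. -/
noncomputable def diagMap (s : Finset (Fin 3)) (f : ∀ n, Module.End ℂ (SpinSpace n)) :
    Module.End ℂ (SpinTensor n₁ n₂ n₃) :=
  ∑ a ∈ s, siteMap n₁ n₂ n₃ a f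

variable {n₁ n₂ n₃}

theorem diagMap_add (s : Finset (Fin 3)) (f g : ∀ n, Module.End ℂ (SpinSpace n)) :
    diagMap n₁ n₂ n₃ s (f + g) = diagMap n₁ n₂ n₃ s f + diagMap n₁ n₂ n₃ s g := by
  simp only [diagMap, siteMap_add, Finset.sum_add_distrib]

theorem diagMap_smul (s : Finset (Fin 3)) (c : ℂ) (f : ∀ n, Module.End ℂ (SpinSpace n)) :
    diagMap n₁ n₂ n₃ s (c • f) = c • diagMap n₁ n₂ n₃ s f := by
  simp only [diagMap, siteMap_smul, Finset.smul_sum]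

theorem sum_lie_sum_eq {R ι κ : Type*} [Ring R] (s : Finset ι) (t : Finset κ) (x : κ → R)
    (y : ι → R) : ⁅∑ b ∈ t, x b, ∑ a ∈ s, y a⁆ = ∑ a ∈ s, ∑ b ∈ t, ⁅x b, y a⁆ := by
  simp only [Ring.lie_def, Finset.sum_sub_distrib]
  rw [Finset.sum_mul_sum, Finset.sum_mul_sum, Finset.sum_comm]

/-- Operators on different factors commute, so only the terms on a common factor survive. Thus total
spin acts on the partial spin of `s` by the bracket of `su(2)`. -/
theorem diagMap_univ_lie (s : Finset (Fin 3)) (f g : ∀ n, Module.End ℂ (SpinSpace n)) :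
    ⁅diagMap n₁ n₂ n₃ Finset.univ f, diagMap n₁ n₂ n₃ s g⁆ =
      diagMap n₁ n₂ n₃ s fun n => ⁅f n, g n⁆ := by
  refine (sum_lie_sum_eq (R := Module.End ℂ (SpinTensor n₁ n₂ n₃)) _ _ _ _).trans (Finset.sum_congr rfl fun a _ => ?_)
  rw [Finset.sum_eq_single a (fun b _ hb => siteMap_lie_of_ne hb f g) (by simp), siteMap_lie_same]

theorem lie_eq_neg_smul {R : Type*} [Ring R] [Algebra ℂ R] {c : ℂ} {x y z : R}
    (h : ⁅y, x⁆ = c • z) : ⁅x, y⁆ = (-c) • z := by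
  rw [neg_smul, ← h, Ring.lie_def, Ring.lie_def, neg_sub]

/-- Bracketing with `S` acts as an infinitesimal rotation of `(y, z)` fixing `x`: the contributions
`±c(zy + yz)` of `y²` and `z²` cancel. -/
theorem commute_sum_sq {R : Type*} [Ring R] [Algebra ℂ R] {c : ℂ} {S x y z : R} (hx : ⁅S, x⁆ = 0)
    (hy : ⁅S, y⁆ = c • z) (hz : ⁅S, z⁆ = (-c) • y) :
    S * (x ^ 2 + y ^ 2 + z ^ 2) = (x ^ 2 + y ^ 2 + z ^ 2) * S := by
  rw [Ring.lie_def, sub_eq_iff_eq_add] at hx hy hz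
  rw [neg_smul] at hz
  have h2 : S * y * y = c • (z * y + y * z) + y * y * S := by
    rw [hy, add_mul, mul_assoc y S, hy, mul_add, smul_mul_assoc, mul_smul_comm, smul_add, mul_assoc,
      add_assoc]
  have h3 : S * z * z = -(c • (z * y + y * z)) + z * z * S := by
    rw [hz, add_mul, mul_assoc z S, hz, mul_add, neg_mul, mul_neg, smul_mul_assoc, mul_smul_comm,
      smul_add, mul_assoc z z]
    abel
  rw [mul_add, mul_add, pow_two, pow_two, pow_two, ← mul_assoc, ← mul_assoc, ← mul_assoc, h2, h3,
    hx, zero_add, mul_assoc x S, hx, zero_add, add_mul, add_mul, mul_assoc x]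
  abel

theorem siteCasimir_mem_spinCentralizer (s : Finset (Fin 3)) :
    siteCasimir n₁ n₂ n₃ s ∈ spinCentralizer n₁ n₂ n₃ := by
  rw [spinCentralizer, Subalgebra.mem_centralizer_iff]
  rintro _ ⟨α, rfl⟩
  change diagMap n₁ n₂ n₃ Finset.univ (fun n => spin n α) *
      (∑ β, diagMap n₁ n₂ n₃ s (fun n => spin n β) ^ 2) =
    (∑ β, diagMap n₁ n₂ n₃ s (fun n => spin n β) ^ 2) *
      diagMap n₁ n₂ n₃ Finset.univ fun n => spin n α
  -- The sum is started at `α`, so that the axis of rotation comes first and one cyclic relation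
  -- `spin_comm` serves all three `α`.
  have hsum (f : Fin 3 → Module.End ℂ (SpinTensor n₁ n₂ n₃)) :
      ∑ β, f β = f α + f (α + 1) + f (α + 2) := by
    rw [Fin.sum_univ_three]
    fin_cases α
    · rfl
    · change f 0 + f 1 + f 2 = f 1 + f 2 + f 0
      abel
    · change f 0 + f 1 + f 2 = f 2 + f 0 + f 1
      abel
  have h21 : α + 2 + 1 = α := by fin_cases α <;> rfl
  have h22 : α + 2 + 2 = α + 1 := by fin_cases α <;> rfl
  rw [hsum]
  refine commute_sum_sq (R := Module.End ℂ (SpinTensor n₁ n₂ n₃)) (c := Complex.I) ?_ ?_ ?_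
  · rw [diagMap_univ_lie]
    have h0 : (fun n => ⁅spin n α, spin n α⁆) = (0 : ℂ) • fun n => spin n α := by
      funext n
      rw [Ring.lie_def, sub_self, Pi.smul_apply, zero_smul]
    rw [h0, diagMap_smul, zero_smul]
  · rw [diagMap_univ_lie, ← diagMap_smul]
    exact congrArg _ (funext fun n => spin_comm n α)
  · rw [diagMap_univ_lie, ← diagMap_smul]
    refine congrArg _ (funext fun n => ?_)
    have h := spin_comm n (α + 2)
    rw [h21, h22] at h
    exact lie_eq_neg_smul h

theorem I_mul_neg_I_div_two : Complex.I * (-Complex.I / 2) = 1 / 2 := by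
  linear_combination (-1 / 2) * Complex.I_mul_I

theorem spinPlus_eq : spinPlus = (fun n => spin n 0) + Complex.I • fun n => spin n 1 := by
  funext n
  simp only [Pi.add_apply, Pi.smul_apply, spin, Matrix.cons_val, smul_smul, I_mul_neg_I_div_two]
  module

theorem spinMinus_eq : spinMinus = (fun n => spin n 0) + (-Complex.I) • fun n => spin n 1 := by
  funext n
  simp only [Pi.add_apply, Pi.smul_apply, spin, Matrix.cons_val, smul_smul, neg_mul,
    I_mul_neg_I_div_two]
  module

/-- In terms of raising, lowering and weight operators no imaginary unit remains, and the Casimirs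
act with rational coefficients on the product basis. -/
theorem siteCasimir_eq (s : Finset (Fin 3)) :
    siteCasimir n₁ n₂ n₃ s = diagMap n₁ n₂ n₃ s spinWeight ^ 2 + (1 / 2 : ℂ) •
      (diagMap n₁ n₂ n₃ s spinPlus * diagMap n₁ n₂ n₃ s spinMinus +
        diagMap n₁ n₂ n₃ s spinMinus * diagMap n₁ n₂ n₃ s spinPlus) := by
  have hw : spinWeight = fun n => spin n 2 := rfl
  have h : siteCasimir n₁ n₂ n₃ s = ∑ β, diagMap n₁ n₂ n₃ s (fun n => spin n β) ^ 2 := rfl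
  rw [h, hw, spinPlus_eq, spinMinus_eq, Fin.sum_univ_three]
  simp only [diagMap_add, diagMap_smul, add_mul, mul_add, smul_mul_assoc, mul_smul_comm, smul_add,
    smul_smul, pow_two]
  have hI : Complex.I * -Complex.I = 1 := by rw [mul_neg, Complex.I_mul_I, neg_neg]
  have hI' : -Complex.I * Complex.I = 1 := by rw [neg_mul, Complex.I_mul_I, neg_neg]
  rw [hI, hI']
  module

theorem commute_diagMap_of_mem_spinCentralizer {X : Module.End ℂ (SpinTensor n₁ n₂ n₃)}
    (hX : X ∈ spinCentralizer n₁ n₂ n₃) (α : Fin 3) :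
    Commute X (diagMap n₁ n₂ n₃ Finset.univ fun n => spin n α) := by
  rw [spinCentralizer, Subalgebra.mem_centralizer_iff] at hX
  exact (hX _ ⟨α, rfl⟩).symm

theorem commute_diagMap_spinPlus {X : Module.End ℂ (SpinTensor n₁ n₂ n₃)}
    (hX : X ∈ spinCentralizer n₁ n₂ n₃) : Commute X (diagMap n₁ n₂ n₃ Finset.univ spinPlus) := by
  rw [spinPlus_eq, diagMap_add, diagMap_smul]
  exact (commute_diagMap_of_mem_spinCentralizer hX 0).add_right
    ((commute_diagMap_of_mem_spinCentralizer hX 1).smul_right _)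

theorem commute_diagMap_spinMinus {X : Module.End ℂ (SpinTensor n₁ n₂ n₃)}
    (hX : X ∈ spinCentralizer n₁ n₂ n₃) : Commute X (diagMap n₁ n₂ n₃ Finset.univ spinMinus) := by
  rw [spinMinus_eq, diagMap_add, diagMap_smul]
  exact (commute_diagMap_of_mem_spinCentralizer hX 0).add_right
    ((commute_diagMap_of_mem_spinCentralizer hX 1).smul_right _)

theorem commute_diagMap_spinWeight {X : Module.End ℂ (SpinTensor n₁ n₂ n₃)}
    (hX : X ∈ spinCentralizer n₁ n₂ n₃) : Commute X (diagMap n₁ n₂ n₃ Finset.univ spinWeight) :=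
  commute_diagMap_of_mem_spinCentralizer hX 2

end SiteOperators

/-! ### Coordinates on the tensor product -/

section Coordinates

open TensorProduct

variable (n₁ n₂ n₃ : ℕ)

/-- The product basis of the threefold tensor product. -/
noncomputable def spinBasis :
    Module.Basis (Fin (n₁ + 1) × Fin (n₂ + 1) × Fin (n₃ + 1)) ℂ (SpinTensor n₁ n₂ n₃) :=
  (Pi.basisFun ℂ _).tensorProduct ((Pi.basisFun ℂ _).tensorProduct (Pi.basisFun ℂ _))

variable {n₁ n₂ n₃}

/-- The coordinates with respect to the product basis. -/
noncomputable def coord (i : Fin (n₁ + 1)) (j : Fin (n₂ + 1)) (k : Fin (n₃ + 1)) :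
    SpinTensor n₁ n₂ n₃ →ₗ[ℂ] ℂ :=
  (spinBasis n₁ n₂ n₃).coord (i, j, k)

theorem coord_tmul (i : Fin (n₁ + 1)) (j : Fin (n₂ + 1)) (k : Fin (n₃ + 1)) (u : SpinSpace n₁)
    (v : SpinSpace n₂) (w : SpinSpace n₃) : coord i j k (u ⊗ₜ (v ⊗ₜ w)) = u i * (v j * w k) := by
  simp [coord, spinBasis, mul_comm]

theorem spinBasis_apply (i : Fin (n₁ + 1)) (j : Fin (n₂ + 1)) (k : Fin (n₃ + 1)) :
    spinBasis n₁ n₂ n₃ (i, j, k) = Pi.single i 1 ⊗ₜ (Pi.single j 1 ⊗ₜ Pi.single k 1) := by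
  simp [spinBasis]

theorem ext_coord {x y : SpinTensor n₁ n₂ n₃} (h : ∀ i j k, coord i j k x = coord i j k y) :
    x = y :=
  (spinBasis n₁ n₂ n₃).ext_elem fun ⟨i, j, k⟩ => h i j k

theorem induction_tmul {p : SpinTensor n₁ n₂ n₃ → Prop} (x : SpinTensor n₁ n₂ n₃)
    (h0 : p 0) (ht : ∀ u v w, p (u ⊗ₜ (v ⊗ₜ w))) (ha : ∀ x y, p x → p y → p (x + y)) : p x := by
  induction x using TensorProduct.induction_on with
  | zero => exact h0
  | add x y hx hy => exact ha x y hx hy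
  | tmul u y =>
    induction y using TensorProduct.induction_on with
    | zero => simpa using h0
    | tmul v w => exact ht u v w
    | add y z hy hz => rw [tmul_add]; exact ha _ _ hy hz

/-- A vector is treated as a three-index array, on which a site operator acts along one index with
the other two fixed. This lets arbitrary, not only pure, tensors be computed with. -/
theorem coord_siteMap_zero (f : ∀ n, Module.End ℂ (SpinSpace n)) (x : SpinTensor n₁ n₂ n₃)
    (i : Fin (n₁ + 1)) (j : Fin (n₂ + 1)) (k : Fin (n₃ + 1)) :
    coord i j k (siteMap n₁ n₂ n₃ 0 f x) = f n₁ (fun i' => coord i' j k x) i := by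
  refine induction_tmul (p := fun x => coord i j k (siteMap n₁ n₂ n₃ 0 f x) =
    f n₁ (fun i' => coord i' j k x) i) x ?_ (fun u v w => ?_) fun x y hx hy => ?_
  · simp only [map_zero]
    exact (congrFun (map_zero (f n₁)) i).symm
  · have : (fun i' => coord i' j k (u ⊗ₜ (v ⊗ₜ w))) = (v j * w k) • u := by
      funext i'
      simp only [coord_tmul, Pi.smul_apply, smul_eq_mul]
      ring
    rw [this, siteMap_zero_tmul, coord_tmul, map_smul, Pi.smul_apply, smul_eq_mul, mul_comm]
  · have : (fun i' => coord i' j k (x + y)) =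
        (fun i' => coord i' j k x) + fun i' => coord i' j k y := by
      funext i'
      simp
    rw [this, map_add, map_add, map_add, hx, hy, Pi.add_apply]

theorem coord_siteMap_one (f : ∀ n, Module.End ℂ (SpinSpace n)) (x : SpinTensor n₁ n₂ n₃)
    (i : Fin (n₁ + 1)) (j : Fin (n₂ + 1)) (k : Fin (n₃ + 1)) :
    coord i j k (siteMap n₁ n₂ n₃ 1 f x) = f n₂ (fun j' => coord i j' k x) j := by
  refine induction_tmul (p := fun x => coord i j k (siteMap n₁ n₂ n₃ 1 f x) =
    f n₂ (fun j' => coord i j' k x) j) x ?_ (fun u v w => ?_) fun x y hx hy => ?_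
  · simp only [map_zero]
    exact (congrFun (map_zero (f n₂)) j).symm
  · have : (fun j' => coord i j' k (u ⊗ₜ (v ⊗ₜ w))) = (u i * w k) • v := by
      funext j'
      simp only [coord_tmul, Pi.smul_apply, smul_eq_mul]
      ring
    rw [this, siteMap_one_tmul, coord_tmul, map_smul, Pi.smul_apply, smul_eq_mul]
    ring
  · have : (fun j' => coord i j' k (x + y)) =
        (fun j' => coord i j' k x) + fun j' => coord i j' k y := by
      funext j'
      simp
    rw [this, map_add, map_add, map_add, hx, hy, Pi.add_apply]

theorem coord_siteMap_two (f : ∀ n, Module.End ℂ (SpinSpace n)) (x : SpinTensor n₁ n₂ n₃)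
    (i : Fin (n₁ + 1)) (j : Fin (n₂ + 1)) (k : Fin (n₃ + 1)) :
    coord i j k (siteMap n₁ n₂ n₃ 2 f x) = f n₃ (fun k' => coord i j k' x) k := by
  refine induction_tmul (p := fun x => coord i j k (siteMap n₁ n₂ n₃ 2 f x) =
    f n₃ (fun k' => coord i j k' x) k) x ?_ (fun u v w => ?_) fun x y hx hy => ?_
  · simp only [map_zero]
    exact (congrFun (map_zero (f n₃)) k).symm
  · have : (fun k' => coord i j k' (u ⊗ₜ (v ⊗ₜ w))) = (u i * v j) • w := by
      funext k'
      simp only [coord_tmul, Pi.smul_apply, smul_eq_mul]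
      ring
    rw [this, siteMap_two_tmul, coord_tmul, map_smul, Pi.smul_apply, smul_eq_mul]
    ring
  · have : (fun k' => coord i j k' (x + y)) =
        (fun k' => coord i j k' x) + fun k' => coord i j k' y := by
      funext k'
      simp
    rw [this, map_add, map_add, map_add, hx, hy, Pi.add_apply]

end Coordinates

/-! ### The highest weight vectors of spin 1/2, 3/2 and 5/2 -/

section HighestWeight

@[simp]
theorem spinPlus_one_zero (v : SpinSpace 1) : spinPlus 1 v 0 = v 1 := by
  simp [spinPlus_apply]

@[simp]
theorem spinPlus_one_one (v : SpinSpace 1) : spinPlus 1 v 1 = 0 := by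
  simp [spinPlus_apply]

@[simp]
theorem spinPlus_two_zero (v : SpinSpace 2) : spinPlus 2 v 0 = v 1 := by
  simp [spinPlus_apply]

@[simp]
theorem spinPlus_two_one (v : SpinSpace 2) : spinPlus 2 v 1 = 2 * v 2 := by
  norm_num [spinPlus_apply]
  rfl

@[simp]
theorem spinPlus_two_two (v : SpinSpace 2) : spinPlus 2 v 2 = 0 := by
  simp [spinPlus_apply]

@[simp]
theorem spinMinus_one_zero (v : SpinSpace 1) : spinMinus 1 v 0 = 0 := by
  simp [spinMinus_apply]

@[simp]
theorem spinMinus_one_one (v : SpinSpace 1) : spinMinus 1 v 1 = v 0 := by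
  simp [spinMinus_apply]

@[simp]
theorem spinMinus_two_zero (v : SpinSpace 2) : spinMinus 2 v 0 = 0 := by
  simp [spinMinus_apply]

@[simp]
theorem spinMinus_two_one (v : SpinSpace 2) : spinMinus 2 v 1 = 2 * v 0 := by
  simp [spinMinus_apply]

@[simp]
theorem spinMinus_two_two (v : SpinSpace 2) : spinMinus 2 v 2 = v 1 := by
  norm_num [spinMinus_apply]

@[simp]
theorem spinWeight_one_zero (v : SpinSpace 1) : spinWeight 1 v 0 = 1 / 2 * v 0 := by
  norm_num [spinWeight_apply]

@[simp]
theorem spinWeight_one_one (v : SpinSpace 1) : spinWeight 1 v 1 = -1 / 2 * v 1 := by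
  norm_num [spinWeight_apply]

@[simp]
theorem spinWeight_two_zero (v : SpinSpace 2) : spinWeight 2 v 0 = v 0 := by
  norm_num [spinWeight_apply]

@[simp]
theorem spinWeight_two_one (v : SpinSpace 2) : spinWeight 2 v 1 = 0 := by
  norm_num [spinWeight_apply]

@[simp]
theorem spinWeight_two_two (v : SpinSpace 2) : spinWeight 2 v 2 = -v 2 := by
  norm_num [spinWeight_apply]

theorem coord_diagMap_univ (f : ∀ n, Module.End ℂ (SpinSpace n)) (x : SpinTensor 1 2 2)
    (i : Fin 2) (j k : Fin 3) : coord i j k (diagMap 1 2 2 Finset.univ f x) =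
      f 1 (fun i' => coord i' j k x) i + f 2 (fun j' => coord i j' k x) j +
        f 2 (fun k' => coord i j k' x) k := by
  rw [diagMap, Fin.sum_univ_three, LinearMap.add_apply, LinearMap.add_apply, map_add, map_add]
  rw [coord_siteMap_zero, coord_siteMap_one, coord_siteMap_two]

theorem coord_diagMap_zero_one (f : ∀ n, Module.End ℂ (SpinSpace n)) (x : SpinTensor 1 2 2)
    (i : Fin 2) (j k : Fin 3) : coord i j k (diagMap 1 2 2 {0, 1} f x) =
      f 1 (fun i' => coord i' j k x) i + f 2 (fun j' => coord i j' k x) j := by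
  rw [diagMap, Finset.sum_pair (by decide), LinearMap.add_apply, map_add]
  rw [coord_siteMap_zero, coord_siteMap_one]

theorem coord_diagMap_one_two (f : ∀ n, Module.End ℂ (SpinSpace n)) (x : SpinTensor 1 2 2)
    (i : Fin 2) (j k : Fin 3) : coord i j k (diagMap 1 2 2 {1, 2} f x) =
      f 2 (fun j' => coord i j' k x) j + f 2 (fun k' => coord i j k' x) k := by
  rw [diagMap, Finset.sum_pair (by decide), LinearMap.add_apply, map_add]
  rw [coord_siteMap_one, coord_siteMap_two]

theorem coord_siteCasimir (s : Finset (Fin 3)) (x : SpinTensor 1 2 2) (i : Fin 2) (j k : Fin 3) :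
    coord i j k (siteCasimir 1 2 2 s x) =
      coord i j k (diagMap 1 2 2 s spinWeight (diagMap 1 2 2 s spinWeight x)) + 1 / 2 *
        (coord i j k (diagMap 1 2 2 s spinPlus (diagMap 1 2 2 s spinMinus x)) +
          coord i j k (diagMap 1 2 2 s spinMinus (diagMap 1 2 2 s spinPlus x))) := by
  rw [siteCasimir_eq, pow_two]
  simp only [LinearMap.add_apply, LinearMap.smul_apply, Module.End.mul_apply, map_add, map_smul,
    smul_eq_mul]

@[simp]
theorem coord_spinBasis (i i' : Fin 2) (j j' k k' : Fin 3) :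
    coord i j k (spinBasis 1 2 2 (i', j', k')) = if i' = i ∧ j' = j ∧ k' = k then 1 else 0 := by
  rw [coord, Module.Basis.coord_apply, Module.Basis.repr_self, Finsupp.single_apply]
  simp only [Prod.mk.injEq]

/-- The two highest weight vectors of spin `1/2`. -/
noncomputable def hwHalf : Fin 2 → SpinTensor 1 2 2 :=
  ![spinBasis 1 2 2 (0, 0, 2) - (2 : ℂ) • spinBasis 1 2 2 (0, 1, 1) + spinBasis 1 2 2 (0, 2, 0),
    spinBasis 1 2 2 (0, 0, 2) - spinBasis 1 2 2 (0, 1, 1) - spinBasis 1 2 2 (1, 0, 1) +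
      spinBasis 1 2 2 (1, 1, 0)]

/-- The two highest weight vectors of spin `3/2`. -/
noncomputable def hwThreeHalves : Fin 2 → SpinTensor 1 2 2 :=
  ![spinBasis 1 2 2 (0, 1, 0) - spinBasis 1 2 2 (0, 0, 1),
    spinBasis 1 2 2 (1, 0, 0) - spinBasis 1 2 2 (0, 0, 1)]

/-- The highest weight vector of spin `5/2`. -/
noncomputable def hwFiveHalves : SpinTensor 1 2 2 := spinBasis 1 2 2 (0, 0, 0)

/-- Coordinates on the highest weight vectors of spin `1/2`. -/
noncomputable def coordHalf : Fin 2 → SpinTensor 1 2 2 →ₗ[ℂ] ℂ :=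
  ![coord (n₁ := 1) (n₂ := 2) (n₃ := 2) 0 2 0, coord (n₁ := 1) (n₂ := 2) (n₃ := 2) 1 1 0]

/-- Coordinates on the highest weight vectors of spin `3/2`. -/
noncomputable def coordThreeHalves : Fin 2 → SpinTensor 1 2 2 →ₗ[ℂ] ℂ :=
  ![coord (n₁ := 1) (n₂ := 2) (n₃ := 2) 0 1 0, coord (n₁ := 1) (n₂ := 2) (n₃ := 2) 1 0 0]

/-- The product vector `(i, j, k)` has weight `5/2 - (i + j + k)`, so weight 1/2 leaves five
coordinates. The raising operator imposes three equations on them, and the two coordinates in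
`coordHalf` determine the rest. -/
theorem eq_hwHalf {x : SpinTensor 1 2 2} (hP : diagMap 1 2 2 Finset.univ spinPlus x = 0)
    (hZ : diagMap 1 2 2 Finset.univ spinWeight x = (1 / 2 : ℂ) • x) :
    x = ∑ i, coordHalf i x • hwHalf i := by
  have p (i j k) := congrArg (coord (n₁ := 1) (n₂ := 2) (n₃ := 2) i j k) hP
  have z (i j k) := congrArg (coord (n₁ := 1) (n₂ := 2) (n₃ := 2) i j k) hZ
  simp only [coord_diagMap_univ, map_zero, map_smul, smul_eq_mul] at p z
  have p1 := p 0 0 1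
  have p2 := p 0 1 0
  have p3 := p 1 0 0
  simp only [spinPlus_one_zero, spinPlus_one_one, spinPlus_two_zero, spinPlus_two_one] at p1 p2 p3
  refine ext_coord fun i j k => ?_
  -- The weight equation at one index triple kills this coordinate unless `i + j + k = 2`.
  have z' := z i j k
  clear z p hP hZ
  simp only [Fin.sum_univ_two, hwHalf, coordHalf, Matrix.cons_val_zero, Matrix.cons_val_one, map_add,
    map_sub, map_smul, smul_eq_mul, coord_spinBasis]
  fin_cases i <;> fin_cases j <;> fin_cases k <;> simp at z' ⊢ <;> grind

theorem eq_hwThreeHalves {x : SpinTensor 1 2 2} (hP : diagMap 1 2 2 Finset.univ spinPlus x = 0)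
    (hZ : diagMap 1 2 2 Finset.univ spinWeight x = (3 / 2 : ℂ) • x) :
    x = ∑ i, coordThreeHalves i x • hwThreeHalves i := by
  have p (i j k) := congrArg (coord (n₁ := 1) (n₂ := 2) (n₃ := 2) i j k) hP
  have z (i j k) := congrArg (coord (n₁ := 1) (n₂ := 2) (n₃ := 2) i j k) hZ
  simp only [coord_diagMap_univ, map_zero, map_smul, smul_eq_mul] at p z
  have p1 := p 0 0 0
  simp only [spinPlus_one_zero, spinPlus_two_zero] at p1
  refine ext_coord fun i j k => ?_
  have z' := z i j k
  clear z p hP hZ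
  simp only [Fin.sum_univ_two, hwThreeHalves, coordThreeHalves, Matrix.cons_val_zero,
    Matrix.cons_val_one, map_add, map_sub, map_smul, smul_eq_mul, coord_spinBasis]
  fin_cases i <;> fin_cases j <;> fin_cases k <;> simp at z' ⊢ <;> grind

/-- The top weight space is the line through `(0, 0, 0)`, so the weight alone decides. -/
theorem eq_hwFiveHalves {x : SpinTensor 1 2 2}
    (hZ : diagMap 1 2 2 Finset.univ spinWeight x = (5 / 2 : ℂ) • x) :
    x = coord (n₁ := 1) (n₂ := 2) (n₃ := 2) 0 0 0 x • hwFiveHalves := by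
  have z (i j k) := congrArg (coord (n₁ := 1) (n₂ := 2) (n₃ := 2) i j k) hZ
  simp only [coord_diagMap_univ, map_smul, smul_eq_mul] at z
  refine ext_coord fun i j k => ?_
  have z' := z i j k
  clear z hZ
  simp only [hwFiveHalves, map_smul, smul_eq_mul, coord_spinBasis]
  fin_cases i <;> fin_cases j <;> fin_cases k <;> simp at z' ⊢ <;> grind

end HighestWeight

/-! ### The lowering operator generates everything from highest weight vectors -/

section Generation

theorem spinMinus_one_single (i : Fin 2) : spinMinus 1 (Pi.single i 1) =
    (![Pi.single 1 1, 0] : Fin 2 → SpinSpace 1) i := by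
  funext i'
  fin_cases i <;> fin_cases i' <;> simp

theorem spinMinus_two_single (j : Fin 3) : spinMinus 2 (Pi.single j 1) =
    (![(2 : ℂ) • Pi.single 1 1, Pi.single 2 1, 0] : Fin 3 → SpinSpace 2) j := by
  funext j'
  fin_cases j <;> fin_cases j' <;> simp

theorem lower_spinBasis (i : Fin 2) (j k : Fin 3) :
    diagMap 1 2 2 Finset.univ spinMinus (spinBasis 1 2 2 (i, j, k)) =
      (![spinBasis 1 2 2 (1, j, k), 0] : Fin 2 → _) i +
      (![(2 : ℂ) • spinBasis 1 2 2 (i, 1, k), spinBasis 1 2 2 (i, 2, k), 0] : Fin 3 → _) j +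
      (![(2 : ℂ) • spinBasis 1 2 2 (i, j, 1), spinBasis 1 2 2 (i, j, 2), 0] : Fin 3 → _) k := by
  rw [diagMap, Fin.sum_univ_three, LinearMap.add_apply, LinearMap.add_apply]
  simp only [spinBasis_apply, siteMap_zero_tmul, siteMap_one_tmul, siteMap_two_tmul,
    spinMinus_one_single, spinMinus_two_single]
  refine congrArg₂ _ (congrArg₂ _ ?_ ?_) ?_
  · fin_cases i <;> simp
  · fin_cases j <;> simp [TensorProduct.tmul_smul, ← TensorProduct.smul_tmul']
  · fin_cases k <;> simp [TensorProduct.tmul_smul]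

/-- The weight spaces, of dimensions 1, 3, 5, 5, 3, 1, are exhausted from the top. The coefficients
solve the linear systems expressing each product vector through lowered vectors and highest weight
vectors of its weight. -/
theorem eq_top_of_lower_mem {N : Submodule ℂ (SpinTensor 1 2 2)} (h12 : ∀ i, hwHalf i ∈ N)
    (h34 : ∀ i, hwThreeHalves i ∈ N) (h5 : hwFiveHalves ∈ N)
    (hM : ∀ x ∈ N, diagMap 1 2 2 Finset.univ spinMinus x ∈ N) : N = ⊤ := by
  have h1 := h12 0
  have h2 := h12 1
  have h3 := h34 0
  have h4 := h34 1
  simp only [hwHalf, hwThreeHalves, hwFiveHalves, Matrix.cons_val] at h1 h2 h3 h4 h5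
  have n000 : spinBasis 1 2 2 (0, 0, 0) ∈ N := h5
  have n001 : spinBasis 1 2 2 (0, 0, 1) ∈ N := by
    convert N.add_mem (N.add_mem (N.smul_mem (-2/5) h3) (N.smul_mem (-1/5) h4)) (N.smul_mem (1/5)
      (hM _ n000)) using 1
    simp only [lower_spinBasis, Matrix.cons_val]
    module
  have n010 : spinBasis 1 2 2 (0, 1, 0) ∈ N := by
    convert N.add_mem (N.add_mem (N.smul_mem (3/5) h3) (N.smul_mem (-1/5) h4)) (N.smul_mem (1/5)
      (hM _ n000)) using 1
    simp only [lower_spinBasis, Matrix.cons_val]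
    module
  have n100 : spinBasis 1 2 2 (1, 0, 0) ∈ N := by
    convert N.add_mem (N.add_mem (N.smul_mem (-2/5) h3) (N.smul_mem (4/5) h4)) (N.smul_mem (1/5)
      (hM _ n000)) using 1
    simp only [lower_spinBasis, Matrix.cons_val]
    module
  -- Weight 1/2: the three lowered vectors of weight 3/2 are completed by the two vectors `hwHalf`.
  have n002 : spinBasis 1 2 2 (0, 0, 2) ∈ N := by
    convert N.add_mem (N.add_mem (N.add_mem (N.add_mem (N.smul_mem (1/6) h1) (N.smul_mem (1/3)
      h2)) (N.smul_mem (1/2) (hM _ n001))) (N.smul_mem (-1/6) (hM _ n010))) (N.smul_mem (-1/12)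
      (hM _ n100)) using 1
    simp only [lower_spinBasis, Matrix.cons_val]
    module
  have n011 : spinBasis 1 2 2 (0, 1, 1) ∈ N := by
    convert N.add_mem (N.add_mem (N.add_mem (N.smul_mem (-1/6) h1) (N.smul_mem (1/6) (hM _
      n001))) (N.smul_mem (1/6) (hM _ n010))) (N.smul_mem (-1/12) (hM _ n100)) using 1
    simp only [lower_spinBasis, Matrix.cons_val]
    module
  have n020 : spinBasis 1 2 2 (0, 2, 0) ∈ N := by
    convert N.add_mem (N.add_mem (N.add_mem (N.add_mem (N.smul_mem (1/2) h1) (N.smul_mem (-1/3)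
      h2)) (N.smul_mem (-1/6) (hM _ n001))) (N.smul_mem (1/2) (hM _ n010))) (N.smul_mem (-1/12)
      (hM _ n100)) using 1
    simp only [lower_spinBasis, Matrix.cons_val]
    module
  have n101 : spinBasis 1 2 2 (1, 0, 1) ∈ N := by
    convert N.add_mem (N.add_mem (N.add_mem (N.add_mem (N.smul_mem (1/6) h1) (N.smul_mem (-1/3)
      h2)) (N.smul_mem (1/6) (hM _ n001))) (N.smul_mem (-1/6) (hM _ n010))) (N.smul_mem (1/4) (hM
      _ n100)) using 1
    simp only [lower_spinBasis, Matrix.cons_val]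
    module
  have n110 : spinBasis 1 2 2 (1, 1, 0) ∈ N := by
    convert N.add_mem (N.add_mem (N.add_mem (N.add_mem (N.smul_mem (-1/6) h1) (N.smul_mem (1/3)
      h2)) (N.smul_mem (-1/6) (hM _ n001))) (N.smul_mem (1/6) (hM _ n010))) (N.smul_mem (1/4) (hM
      _ n100)) using 1
    simp only [lower_spinBasis, Matrix.cons_val]
    module
  -- From weight -1/2 downwards there are no new highest weight vectors, and lowering alone is onto.
  have n012 : spinBasis 1 2 2 (0, 1, 2) ∈ N := by
    convert N.add_mem (N.add_mem (N.add_mem (N.add_mem (N.smul_mem (1/3) (hM _ n002)) (N.smul_mem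
      (1/3) (hM _ n011))) (N.smul_mem (-1/6) (hM _ n020))) (N.smul_mem (-1/3) (hM _ n101)))
      (N.smul_mem (1/6) (hM _ n110)) using 1
    simp only [lower_spinBasis, Matrix.cons_val]
    module
  have n021 : spinBasis 1 2 2 (0, 2, 1) ∈ N := by
    convert N.add_mem (N.add_mem (N.add_mem (N.add_mem (N.smul_mem (-1/6) (hM _ n002))
      (N.smul_mem (1/3) (hM _ n011))) (N.smul_mem (1/3) (hM _ n020))) (N.smul_mem (1/6) (hM _
      n101))) (N.smul_mem (-1/3) (hM _ n110)) using 1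
    simp only [lower_spinBasis, Matrix.cons_val]
    module
  have n102 : spinBasis 1 2 2 (1, 0, 2) ∈ N := by
    convert N.add_mem (N.add_mem (N.add_mem (N.add_mem (N.smul_mem (1/3) (hM _ n002)) (N.smul_mem
      (-2/3) (hM _ n011))) (N.smul_mem (1/3) (hM _ n020))) (N.smul_mem (2/3) (hM _ n101)))
      (N.smul_mem (-1/3) (hM _ n110)) using 1
    simp only [lower_spinBasis, Matrix.cons_val]
    module
  have n111 : spinBasis 1 2 2 (1, 1, 1) ∈ N := by
    convert N.add_mem (N.add_mem (N.add_mem (N.add_mem (N.smul_mem (-1/6) (hM _ n002))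
      (N.smul_mem (1/3) (hM _ n011))) (N.smul_mem (-1/6) (hM _ n020))) (N.smul_mem (1/6) (hM _
      n101))) (N.smul_mem (1/6) (hM _ n110)) using 1
    simp only [lower_spinBasis, Matrix.cons_val]
    module
  have n120 : spinBasis 1 2 2 (1, 2, 0) ∈ N := by
    convert N.add_mem (N.add_mem (N.add_mem (N.add_mem (N.smul_mem (1/3) (hM _ n002)) (N.smul_mem
      (-2/3) (hM _ n011))) (N.smul_mem (1/3) (hM _ n020))) (N.smul_mem (-1/3) (hM _ n101)))
      (N.smul_mem (2/3) (hM _ n110)) using 1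
    simp only [lower_spinBasis, Matrix.cons_val]
    module
  have n022 : spinBasis 1 2 2 (0, 2, 2) ∈ N := by
    convert N.add_mem (N.smul_mem (1) (hM _ n012)) (N.smul_mem (-1/2) (hM _ n102)) using 1
    simp only [lower_spinBasis, Matrix.cons_val]
    module
  have n112 : spinBasis 1 2 2 (1, 1, 2) ∈ N := by
    convert N.smul_mem (1/2) (hM _ n102) using 1
    simp only [lower_spinBasis, Matrix.cons_val]
    module
  have n121 : spinBasis 1 2 2 (1, 2, 1) ∈ N := by
    convert N.add_mem (N.add_mem (N.smul_mem (-1) (hM _ n012)) (N.smul_mem (1) (hM _ n021)))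
      (N.smul_mem (1/2) (hM _ n102)) using 1
    simp only [lower_spinBasis, Matrix.cons_val]
    module
  have n122 : spinBasis 1 2 2 (1, 2, 2) ∈ N := by
    convert N.smul_mem (1) (hM _ n022) using 1
    simp only [lower_spinBasis, Matrix.cons_val]
    module
  rw [eq_top_iff, ← (spinBasis 1 2 2).span_eq, Submodule.span_le]
  rintro _ ⟨⟨i, j, k⟩, rfl⟩
  fin_cases i <;> fin_cases j <;> fin_cases k <;> assumption

end Generation

/-! ### The embedding of the centralizer into the block algebra -/

section Representation

/-- The matrix of an operator in a family of vectors with given coordinate functionals. -/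
def compress {V ι : Type*} [AddCommGroup V] [Module ℂ V] (h : ι → V) (l : ι → V →ₗ[ℂ] ℂ)
    (X : Module.End ℂ V) : Matrix ι ι ℂ :=
  Matrix.of fun i j => l i (X (h j))

/-- Only the operator applied first has to preserve the span of the family; the other one then acts
linearly on the expansion. -/
theorem compress_mul {V ι : Type*} [AddCommGroup V] [Module ℂ V] [Fintype ι] {h : ι → V}
    {l : ι → V →ₗ[ℂ] ℂ} {Y : Module.End ℂ V} (hY : ∀ j, Y (h j) = ∑ i, l i (Y (h j)) • h i)
    (X : Module.End ℂ V) : compress h l (X * Y) = compress h l X * compress h l Y := by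
  ext i j
  simp only [compress, Matrix.of_apply, Matrix.mul_apply, Module.End.mul_apply]
  conv_lhs => rw [hY j]
  simp only [map_sum, map_smul, smul_eq_mul]
  exact Finset.sum_congr rfl fun k _ => mul_comm _ _

theorem plus_hwHalf (i : Fin 2) : diagMap 1 2 2 Finset.univ spinPlus (hwHalf i) = 0 := by
  refine ext_coord fun a b c => ?_
  rw [coord_diagMap_univ, map_zero]
  fin_cases i <;> fin_cases a <;> fin_cases b <;> fin_cases c <;>
  simp [hwHalf]
  norm_num

theorem weight_hwHalf (i : Fin 2) :
    diagMap 1 2 2 Finset.univ spinWeight (hwHalf i) = (1 / 2 : ℂ) • hwHalf i := by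
  refine ext_coord fun a b c => ?_
  rw [coord_diagMap_univ, map_smul]
  fin_cases i <;> fin_cases a <;> fin_cases b <;> fin_cases c <;>
  simp [hwHalf] <;> norm_num

theorem plus_hwThreeHalves (i : Fin 2) :
    diagMap 1 2 2 Finset.univ spinPlus (hwThreeHalves i) = 0 := by
  refine ext_coord fun a b c => ?_
  rw [coord_diagMap_univ, map_zero]
  fin_cases i <;> fin_cases a <;> fin_cases b <;> fin_cases c <;>
  simp [hwThreeHalves]

theorem weight_hwThreeHalves (i : Fin 2) :
    diagMap 1 2 2 Finset.univ spinWeight (hwThreeHalves i) = (3 / 2 : ℂ) • hwThreeHalves i := by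
  refine ext_coord fun a b c => ?_
  rw [coord_diagMap_univ, map_smul]
  fin_cases i <;> fin_cases a <;> fin_cases b <;> fin_cases c <;>
  simp [hwThreeHalves] <;> norm_num

theorem weight_hwFiveHalves :
    diagMap 1 2 2 Finset.univ spinWeight hwFiveHalves = (5 / 2 : ℂ) • hwFiveHalves := by
  refine ext_coord fun a b c => ?_
  rw [coord_diagMap_univ, map_smul]
  fin_cases a <;> fin_cases b <;> fin_cases c <;>
  simp [hwFiveHalves]
  norm_num

theorem Commute.apply_eq_smul {V : Type*} [AddCommGroup V] [Module ℂ V] {X Y : Module.End ℂ V}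
    (h : Commute X Y) {c : ℂ} {v : V} (hv : Y v = c • v) : Y (X v) = c • X v := by
  rw [← Module.End.mul_apply, ← h.eq, Module.End.mul_apply, hv, map_smul]

theorem Commute.apply_eq_zero {V : Type*} [AddCommGroup V] [Module ℂ V] {X Y : Module.End ℂ V}
    (h : Commute X Y) {v : V} (hv : Y v = 0) : Y (X v) = 0 := by
  rw [← Module.End.mul_apply, ← h.eq, Module.End.mul_apply, hv, map_zero]

variable {X : Module.End ℂ (SpinTensor 1 2 2)}

/-- An element of the centralizer commutes with the raising and weight operators, so it maps highest
weight vectors to highest weight vectors of the same weight. -/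
theorem apply_hwHalf (hX : X ∈ spinCentralizer 1 2 2) (j : Fin 2) :
    X (hwHalf j) = ∑ i, coordHalf i (X (hwHalf j)) • hwHalf i :=
  eq_hwHalf ((commute_diagMap_spinPlus hX).apply_eq_zero (plus_hwHalf j))
    ((commute_diagMap_spinWeight hX).apply_eq_smul (weight_hwHalf j))

theorem apply_hwThreeHalves (hX : X ∈ spinCentralizer 1 2 2) (j : Fin 2) :
    X (hwThreeHalves j) = ∑ i, coordThreeHalves i (X (hwThreeHalves j)) • hwThreeHalves i :=
  eq_hwThreeHalves ((commute_diagMap_spinPlus hX).apply_eq_zero (plus_hwThreeHalves j))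
    ((commute_diagMap_spinWeight hX).apply_eq_smul (weight_hwThreeHalves j))

theorem apply_hwFiveHalves (hX : X ∈ spinCentralizer 1 2 2) :
    X hwFiveHalves =
      coord (n₁ := 1) (n₂ := 2) (n₃ := 2) 0 0 0 (X hwFiveHalves) • hwFiveHalves :=
  eq_hwFiveHalves ((commute_diagMap_spinWeight hX).apply_eq_smul weight_hwFiveHalves)

/-- The block matrices of an operator on the highest weight vectors. -/
noncomputable def blockMatrix (X : Module.End ℂ (SpinTensor 1 2 2)) : BlockAlgebra :=
  (compress hwHalf coordHalf X, compress hwThreeHalves coordThreeHalves X,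
    coord (n₁ := 1) (n₂ := 2) (n₃ := 2) 0 0 0 (X hwFiveHalves))

theorem blockMatrix_mul (X : Module.End ℂ (SpinTensor 1 2 2)) {Y : Module.End ℂ (SpinTensor 1 2 2)}
    (hY : Y ∈ spinCentralizer 1 2 2) : blockMatrix (X * Y) = blockMatrix X * blockMatrix Y := by
  refine Prod.ext (compress_mul (apply_hwHalf hY) X)
    (Prod.ext (compress_mul (apply_hwThreeHalves hY) X) ?_)
  simp only [blockMatrix, Module.End.mul_apply, Prod.snd_mul]
  conv_lhs => rw [apply_hwFiveHalves hY]
  rw [map_smul, map_smul, smul_eq_mul, mul_comm]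

theorem blockMatrix_one : blockMatrix 1 = 1 := by
  refine Prod.ext ?_ (Prod.ext ?_ ?_)
  · ext i j
    fin_cases i <;> fin_cases j <;>
    simp [blockMatrix, compress, hwHalf, coordHalf]
  · ext i j
    fin_cases i <;> fin_cases j <;>
    simp [blockMatrix, compress, hwThreeHalves, coordThreeHalves]
  · simp [blockMatrix, hwFiveHalves]

/-- The homomorphism from the centralizer to the block algebra given by the action on highest
weight vectors. -/
noncomputable def blockHom : spinCentralizer 1 2 2 →ₐ[ℂ] BlockAlgebra :=
  AlgHom.ofLinearMap
    { toFun := fun X => blockMatrix X.1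
      map_add' := fun X Y => by
        refine Prod.ext ?_ (Prod.ext ?_ ?_)
        · ext i j
          simp [blockMatrix, compress]
        · ext i j
          simp [blockMatrix, compress]
        · simp [blockMatrix]
      map_smul' := fun c X => by
        refine Prod.ext ?_ (Prod.ext ?_ ?_)
        · ext i j
          simp [blockMatrix, compress]
        · ext i j
          simp [blockMatrix, compress]
        · simp [blockMatrix] }
    blockMatrix_one fun X Y => blockMatrix_mul X.1 Y.2

theorem blockHom_apply (X : spinCentralizer 1 2 2) : blockHom X = blockMatrix X.1 := rfl

/-- The kernel of `X` contains all highest weight vectors and is stable under lowering, because `X`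
commutes with the lowering operator; hence it is the whole space. -/
theorem eq_zero_of_blockMatrix_eq_zero (hX : X ∈ spinCentralizer 1 2 2) (h : blockMatrix X = 0) :
    X = 0 := by
  have h1 (i j) : coordHalf i (X (hwHalf j)) = 0 := congrFun₂ (congrArg Prod.fst h) i j
  have h2 (i j) : coordThreeHalves i (X (hwThreeHalves j)) = 0 :=
    congrFun₂ (congrArg (fun p => p.2.1) h) i j
  have h3 : coord 0 0 0 (X hwFiveHalves) = 0 := congrArg (fun p => p.2.2) h
  have hker : LinearMap.ker X = ⊤ := by
    refine eq_top_of_lower_mem (fun i => ?_) (fun i => ?_) ?_ fun x hx => ?_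
    · rw [LinearMap.mem_ker, apply_hwHalf hX]
      simp [h1]
    · rw [LinearMap.mem_ker, apply_hwThreeHalves hX]
      simp [h2]
    · rw [LinearMap.mem_ker, apply_hwFiveHalves hX, h3, zero_smul]
    · rw [LinearMap.mem_ker] at hx ⊢
      rw [← Module.End.mul_apply, (commute_diagMap_spinMinus hX).eq, Module.End.mul_apply, hx,
        map_zero]
  exact LinearMap.ker_eq_top.mp hker

theorem injective_of_forall_eq_zero {A B : Type*} [Ring A] [Algebra ℂ A] [Ring B] [Algebra ℂ B]
    (S : Subalgebra ℂ A) (ρ : S →ₐ[ℂ] B) (h : ∀ x : S, ρ x = 0 → (x : A) = 0) :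
    Function.Injective ρ :=
  (injective_iff_map_eq_zero ρ).mpr fun x hx => Subtype.ext (h x hx)

theorem blockHom_injective : Function.Injective blockHom :=
  injective_of_forall_eq_zero (A := Module.End ℂ (SpinTensor 1 2 2)) (spinCentralizer 1 2 2)
    blockHom fun x hx => eq_zero_of_blockMatrix_eq_zero x.2 hx

theorem blockMatrix_casimir12 : blockMatrix (casimir12 1 2 2) = blockK12 := by
  rw [casimir12]
  refine Prod.ext ?_ (Prod.ext ?_ ?_)
  · ext i j
    fin_cases i <;> fin_cases j <;>
    simp [blockMatrix, compress, hwHalf, coordHalf, coord_siteCasimir,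
      coord_diagMap_zero_one, blockK12] <;> norm_num
  · ext i j
    fin_cases i <;> fin_cases j <;>
    simp [blockMatrix, compress, hwThreeHalves, coordThreeHalves,
      coord_siteCasimir, coord_diagMap_zero_one, blockK12] <;> norm_num
  · simp [blockMatrix, hwFiveHalves, coord_siteCasimir,
      coord_diagMap_zero_one, blockK12]
    norm_num

theorem blockMatrix_casimir23 : blockMatrix (casimir23 1 2 2) = blockB := by
  rw [casimir23]
  refine Prod.ext ?_ (Prod.ext ?_ ?_)
  · ext i j
    fin_cases i <;> fin_cases j <;>
    simp [blockMatrix, compress, hwHalf, coordHalf, coord_siteCasimir,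
      coord_diagMap_one_two, blockB] <;> norm_num
  · ext i j
    fin_cases i <;> fin_cases j <;>
    simp [blockMatrix, compress, hwThreeHalves, coordThreeHalves,
      coord_siteCasimir, coord_diagMap_one_two, blockB]
    all_goals norm_num
  · simp [blockMatrix, hwFiveHalves, coord_siteCasimir,
      coord_diagMap_one_two, blockB] <;> norm_num

theorem blockMatrix_casimir123 : blockMatrix (casimir123 1 2 2) = blockK123 := by
  have h : ({0, 1, 2} : Finset (Fin 3)) = Finset.univ := by decide
  rw [casimir123, h]
  refine Prod.ext ?_ (Prod.ext ?_ ?_)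
  · ext i j
    fin_cases i <;> fin_cases j <;>
    simp [blockMatrix, compress, hwHalf, coordHalf, coord_siteCasimir,
      coord_diagMap_univ, blockK123] <;> norm_num
  · ext i j
    fin_cases i <;> fin_cases j <;>
    simp [blockMatrix, compress, hwThreeHalves, coordThreeHalves,
      coord_siteCasimir, coord_diagMap_univ, blockK123]
    all_goals norm_num
  · simp [blockMatrix, hwFiveHalves, coord_siteCasimir,
      coord_diagMap_univ, blockK123] <;> norm_num

end Representation

/-! ### Assembling the isomorphisms -/

section Main

theorem finrank_blockAlgebra : Module.finrank ℂ BlockAlgebra = 9 := by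
  simp [BlockAlgebra, Module.finrank_prod, Module.finrank_matrix]

/-- A subalgebra embedded in the block algebra that contains elements with the images of `A`, `B`
and `C` is isomorphic to the quotiented Racah algebra, which has the simplified presentation. -/
theorem exists_equivs_of_injective {R : Type*} [Ring R] [Algebra ℂ R] (S : Subalgebra ℂ R)
    (ρ : S →ₐ[ℂ] BlockAlgebra) (hρ : Function.Injective ρ) {A B C : S}
    (hA : ρ A = blockK12) (hB : ρ B = blockB) (hC : ρ C = blockK123) :
    (∃ φ : QuotientedRacah 1 2 2 ≃ₐ[ℂ] S, φ (quotRacahGen 1 2 2 .A) = A ∧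
      φ (quotRacahGen 1 2 2 .B) = B ∧ φ (quotRacahGen 1 2 2 .C) = C) ∧
    ∃ ψ : SimplifiedAlgebra ≃ₐ[ℂ] QuotientedRacah 1 2 2,
      ψ (simplifiedGen .A) =
        quotRacahGen 1 2 2 .A + algebraMap ℂ (QuotientedRacah 1 2 2) (1 / 4) ∧
      ψ (simplifiedGen .B) = quotRacahGen 1 2 2 .B := by
  obtain ⟨F, FA, FB, FC⟩ := exists_quotientedRacah_hom ρ hρ hA hB hC
  obtain ⟨f, hf, fA, fB⟩ := exists_simplifiedAlgebra_hom_quotientedRacah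
  let g : SimplifiedAlgebra →ₐ[ℂ] BlockAlgebra := ρ.comp (F.comp f)
  have gA : g (simplifiedGen .A) = blockA := by
    simp only [g, AlgHom.comp_apply]
    rw [fA, map_add, AlgHom.commutes, FA, map_add, AlgHom.commutes, hA, blockK12_add]
  have gB : g (simplifiedGen .B) = blockB := by
    simp only [g, AlgHom.comp_apply]
    rw [fB, FB, hB]
  have ginj : Function.Injective g := injective_of_simplifiedGen gA gB
  have : Module.Finite ℂ SimplifiedAlgebra := finite_simplifiedAlgebra
  -- Both ends have dimension 9. Surjectivity of `g` will also show that the centralizer fills the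
  -- block algebra, so its dimension need not be counted separately.
  have gsurj : Function.Surjective g :=
    (LinearMap.injective_iff_surjective_of_finrank_eq_finrank (f := g.toLinearMap)
      (finrank_simplifiedAlgebra.trans finrank_blockAlgebra.symm)).mp ginj
  have finj : Function.Injective f := fun x y hxy => ginj (congrArg (fun z => ρ (F z)) hxy)
  -- Elements are lifted along the surjection `f`, after which injectivity of `g` applies.
  have Finj : Function.Injective F := by
    intro x y hxy
    obtain ⟨x, rfl⟩ := hf x
    obtain ⟨y, rfl⟩ := hf y
    exact congrArg f (ginj (congrArg ρ hxy))
  have Fsurj : Function.Surjective F := by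
    intro s
    obtain ⟨x, hx⟩ := gsurj (ρ s)
    exact ⟨f x, hρ hx⟩
  exact ⟨⟨AlgEquiv.ofBijective F ⟨Finj, Fsurj⟩, FA, FB, FC⟩,
    ⟨AlgEquiv.ofBijective f ⟨finj, hf⟩, fA, fB⟩⟩

theorem exists_spinCentralizer_hom : ∃ (ρ : spinCentralizer 1 2 2 →ₐ[ℂ] BlockAlgebra)
    (A B C : spinCentralizer 1 2 2), Function.Injective ρ ∧
      (A : Module.End ℂ (SpinTensor 1 2 2)) = casimir12 1 2 2 ∧
      (B : Module.End ℂ (SpinTensor 1 2 2)) = casimir23 1 2 2 ∧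
      (C : Module.End ℂ (SpinTensor 1 2 2)) = casimir123 1 2 2 ∧
      ρ A = blockK12 ∧ ρ B = blockB ∧ ρ C = blockK123 :=
  ⟨blockHom, ⟨casimir12 1 2 2, siteCasimir_mem_spinCentralizer {0, 1}⟩,
    ⟨casimir23 1 2 2, siteCasimir_mem_spinCentralizer {1, 2}⟩,
    ⟨casimir123 1 2 2, siteCasimir_mem_spinCentralizer {0, 1, 2}⟩, blockHom_injective, rfl, rfl,
    rfl, (blockHom_apply _).trans blockMatrix_casimir12,
    (blockHom_apply _).trans blockMatrix_casimir23, (blockHom_apply _).trans blockMatrix_casimir123⟩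

theorem exists_spinCentralizer_equivs :
    RacahCentralizerConjecture 1 2 2 ∧ ∃ ψ : SimplifiedAlgebra ≃ₐ[ℂ] QuotientedRacah 1 2 2,
      ψ (simplifiedGen .A) =
        quotRacahGen 1 2 2 .A + algebraMap ℂ (QuotientedRacah 1 2 2) (1 / 4) ∧
      ψ (simplifiedGen .B) = quotRacahGen 1 2 2 .B := by
  obtain ⟨ρ, A, B, C, hρ, hA, hB, hC, ρA, ρB, ρC⟩ := exists_spinCentralizer_hom
  obtain ⟨⟨φ, φA, φB, φC⟩, h⟩ := exists_equivs_of_injective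
    (R := Module.End ℂ (SpinTensor 1 2 2)) (spinCentralizer 1 2 2) ρ hρ ρA ρB ρC
  exact ⟨⟨φ, (congrArg Subtype.val φA).trans hA, (congrArg Subtype.val φB).trans hB,
    (congrArg Subtype.val φC).trans hC⟩, h⟩

theorem mainTheorem6 :
    Module.finrank ℂ (QuotientedRacah 1 2 2) = 9 ∧
    RacahCentralizerConjecture 1 2 2 ∧
    (∃ ψ : SimplifiedAlgebra ≃ₐ[ℂ] QuotientedRacah 1 2 2,
      ψ (simplifiedGen .A) =
        quotRacahGen 1 2 2 .A + algebraMap ℂ (QuotientedRacah 1 2 2) (1 / 4) ∧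
      ψ (simplifiedGen .B) = quotRacahGen 1 2 2 .B) ∧
    (∃ χ : QuotientedRacah 1 2 2 ≃ₐ[ℂ] OneBoundaryBrauer,
      χ (quotRacahGen 1 2 2 .A + algebraMap ℂ (QuotientedRacah 1 2 2) (1 / 4)) =
        4 - 2 * brauerGen .e0 ∧
      χ (quotRacahGen 1 2 2 .B) = 2 * (brauerGen .s1 - brauerGen .e1) + 4) := by
  obtain ⟨hcent, ψ, ψA, ψB⟩ := exists_spinCentralizer_equivs
  obtain ⟨θ, θA, θB⟩ := exists_simplifiedAlgebra_equiv_oneBoundaryBrauer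
  -- The Racah and Brauer algebras are identified through their common two-generator presentation.
  refine ⟨?_, hcent, ⟨ψ, ψA, ψB⟩, ψ.symm.trans θ, ?_, ?_⟩
  · rw [← ψ.toLinearEquiv.finrank_eq, finrank_simplifiedAlgebra]
  · rw [← ψA, AlgEquiv.trans_apply, AlgEquiv.symm_apply_apply, θA]
  · rw [← ψB, AlgEquiv.trans_apply, AlgEquiv.symm_apply_apply, θB]

end Main
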